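/- Let $n\ge 4$. Let $G_{n,2}$ be the Grassmann manifold of complex $2$-planes in $\mathbb C^n$ with its Plücker coordinates $P^{kl}$, Plücker charts $M_{ij}=\{P^{ij}\neq 0\}$, and the standard actions of $T^n=(S^1)^n$ and $(\mathbb C^*)^n$. For a set $\sigma$ of two-element subsets of $\{1,\dots,n\}$, the stratum $W_\sigma$ consists of all $L\in G_{n,2}$ with $P^{kl}(L)\ne 0$ exactly for $\{k,l\}\in\sigma$; its space of parameters is $F_\sigma=W_\sigma/(\mathbb C^*)^n$. Fix a chart $M_{ij}$, $i<j$, in which $L$ is represented by the $n\times 2$ matrix whose rows $i,j$ form the identity matrix and whose other rows are $(z_k,w_k)$, and consider the equations $$c'_{kl}\,z_kw_l=c_{kl}\,z_lw_k,\qquad (c_{kl}:c'_{kl})\in\mathbb CP^1,\quad k<l,\ k,l\ne i,j.\qquad(*)$$ On the main stratum (all $P^{kl}\neq0$) they identify its space of parameters $F_n$ with a subset of $(\mathbb CP^1)^{\binom{n-2}{2}}$, with closure $\bar F_n$. The universal space of parameters $\mathcal F_n$ is the wonderful compactification of $F_n$ with building set the subvarieties $\bar F_S=\{c\in\bar F_n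 : c_{kl}=c'_{kl}\text{ for all }k<l\text{ in }S\}$, $S\subset\{1,\dots,n\}\setminus\{i,j\}$, $|S|\ge 3$; that is, the closure of $F_n$ in the product of the blow-ups of $\bar F_n$ along all $\bar F_S$. For a stratum $W_\sigma\subset M_{ij}$, the virtual space of parameters $\tilde F_\sigma\subset\mathcal F_n$ is the set of all points of $\mathcal F_n$ whose image in $\bar F_n$ satisfies $(*)$ for the coordinates $z,w$ of some point of $W_\sigma$. A point $[L]=T^n\cdot L$ of $G_{n,2}/T^n$ is called singular if, for the stratum $W_\sigma$ containing $L$, the spaces $F_\sigma$ and $\tilde F_\sigma$ are not homeomorphic. Then this notion does not depend on the chart $M_{ij}\supset W_\sigma$ in which $\tilde F_\sigma$ is formed, and a point $[L]\in G_{n,2}/T^n$ is singular if and only if one of the following holds: 1. there is an $i$ with $P^{ij}(L)=0$ for all $j\ne i$; 2. there are $i<j<k$ with $P^{ij}(L)=P^{ik}(L)=P^{jk}(L)=0$. -/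

import Mathlib

open scoped LinearAlgebra.Projectivization

noncomputable section

namespace GrassmannTorus

/-! ### The Grassmann manifold, Plücker coordinates, strata, torus actions -/

/-- The Grassmannian `G_{n,2}` of two-dimensional complex subspaces of `ℂ^n`. -/
def Gr (n : ℕ) : Type := {L : Submodule ℂ (Fin n → ℂ) // Module.finrank ℂ L = 2}

/-- The column space of an `n × 2` matrix. -/
def colSpan {n : ℕ} (A : Matrix (Fin n) (Fin 2) ℂ) : Submodule ℂ (Fin n → ℂ) :=
  Submodule.span ℂ (Set.range fun a : Fin 2 => fun k : Fin n => A k a)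

/-- The space of `n × 2` matrices of rank two (with the subspace topology). -/
abbrev Frames (n : ℕ) : Type :=
  {A : Matrix (Fin n) (Fin 2) ℂ // Module.finrank ℂ (colSpan A) = 2}

/-- The standard topology of `G_{n,2}`: the quotient topology from the rank-two matrices. -/
instance (n : ℕ) : TopologicalSpace (Gr n) :=
  TopologicalSpace.coinduced (fun A : Frames n => (⟨colSpan A.1, A.2⟩ : Gr n)) inferInstance

/-- The `2 × 2` minor of `A` on the rows `k`, `l`. -/
def minor {n : ℕ} (A : Matrix (Fin n) (Fin 2) ℂ) (k l : Fin n) : ℂ :=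
  A k 0 * A l 1 - A k 1 * A l 0

/-- A matrix whose columns form a basis of `L`. -/
def frame {n : ℕ} (L : Gr n) : Matrix (Fin n) (Fin 2) ℂ :=
  fun k a => (Module.finBasisOfFinrankEq ℂ L.1 L.2 a : Fin n → ℂ) k

/-- The Plücker coordinates `P^{kl}(L)`, computed in some basis of `L`; another basis multiplies
all of them by one common non-zero factor. -/
def plucker {n : ℕ} (L : Gr n) (k l : Fin n) : ℂ := minor (frame L) k l

/-- The pairs `k < l` with `P^{kl}(L) ≠ 0`. -/
def support {n : ℕ} (L : Gr n) : Set (Fin n × Fin n) :=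
  {p | p.1 < p.2 ∧ plucker L p.1 p.2 ≠ 0}

/-- The stratum `W_σ`: all `L` with `P^{kl}(L) ≠ 0` for `{k,l} ∈ σ` and `P^{kl}(L) = 0` for
`{k,l} ∉ σ` (a two-element set `{k,l}` is written as the pair `(k,l)` with `k < l`). -/
def stratum {n : ℕ} (σ : Set (Fin n × Fin n)) : Set (Gr n) :=
  {L | ∀ k l : Fin n, k < l → ((k, l) ∈ σ ↔ plucker L k l ≠ 0)}

/-- The diagonal linear automorphism of `ℂ^n` given by an element of the algebraic torus. -/
def torusEquiv {n : ℕ} (t : Fin n → ℂˣ) : (Fin n → ℂ) ≃ₗ[ℂ] (Fin n → ℂ) :=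
  LinearEquiv.piCongrRight fun k => LinearEquiv.smulOfUnit (t k)

/-- The algebraic torus `(ℂ^*)^n` acts on `G_{n,2}`. -/
instance (n : ℕ) : MulAction (Fin n → ℂˣ) (Gr n) where
  smul t L := ⟨L.1.map (torusEquiv t).toLinearMap,
    ((torusEquiv t).submoduleMap L.1).finrank_eq.symm.trans L.2⟩
  one_smul L := by
    apply Subtype.ext
    change L.1.map (torusEquiv 1).toLinearMap = L.1
    have h : (torusEquiv (1 : Fin n → ℂˣ)).toLinearMap = LinearMap.id := by
      ext v k
      simp [torusEquiv, LinearEquiv.smulOfUnit]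
    rw [h, Submodule.map_id]
  mul_smul s t L := by
    apply Subtype.ext
    change L.1.map (torusEquiv (s * t)).toLinearMap =
      (L.1.map (torusEquiv t).toLinearMap).map (torusEquiv s).toLinearMap
    have h : (torusEquiv (s * t)).toLinearMap =
        (torusEquiv s).toLinearMap ∘ₗ (torusEquiv t).toLinearMap := by
      ext v k
      simp [torusEquiv, LinearEquiv.smulOfUnit, mul_smul]
    rw [h, Submodule.map_comp]

/-- The inclusion of the compact torus `T^n` in the algebraic torus. -/
def compactTorus (n : ℕ) : (Fin n → Circle) →* (Fin n → ℂˣ) where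
  toFun t k := Circle.toUnits (t k)
  map_one' := by funext k; simp
  map_mul' s t := by funext k; simp

/-- The compact torus `T^n` acts on `G_{n,2}`. -/
instance (n : ℕ) : MulAction (Fin n → Circle) (Gr n) := MulAction.compHom (Gr n) (compactTorus n)

/-- The orbit space `X_n = G_{n,2} / T^n`. -/
abbrev OrbitSpace (n : ℕ) : Type := MulAction.orbitRel.Quotient (Fin n → Circle) (Gr n)

/-- The point `[L]` of the orbit space. -/
def orbitPoint {n : ℕ} (L : Gr n) : OrbitSpace n :=
  Quotient.mk (MulAction.orbitRel (Fin n → Circle) (Gr n)) L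

/-- The space of parameters `F_σ = W_σ / (ℂ^*)^n`, with the quotient of the subspace topology. -/
abbrev ParameterSpace {n : ℕ} (σ : Set (Fin n × Fin n)) : Type :=
  Quotient ((MulAction.orbitRel (Fin n → ℂˣ) (Gr n)).comap
    (fun L : {L : Gr n // L ∈ stratum σ} => L.1))

/-! ### The universal space of parameters and the virtual spaces of parameters -/

/-- The quotient topology on a complex projective space. -/
instance (ι : Type) : TopologicalSpace (ℙ ℂ (ι → ℂ)) :=
  TopologicalSpace.coinduced
    (fun v : {v : ι → ℂ // v ≠ 0} => Projectivization.mk ℂ v.1 v.2) inferInstance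

/-- The pairs `k < l` of indices different from `i` and `j`. -/
abbrev ChartPair {n : ℕ} (i j : Fin n) : Type :=
  {p : Fin n × Fin n // p.1 < p.2 ∧ p.1 ≠ i ∧ p.1 ≠ j ∧ p.2 ≠ i ∧ p.2 ≠ j}

/-- The sets of at least three indices different from `i` and `j`. -/
abbrev Cluster {n : ℕ} (i j : Fin n) : Type :=
  {S : Finset (Fin n) // i ∉ S ∧ j ∉ S ∧ 3 ≤ S.card}

/-- The matrix with local coordinates `z`, `w` in the Plücker chart `M_{ij}`: its rows `i`, `j`
form the identity matrix, its row `k` is `(z_k, w_k)` for `k ≠ i, j` (the values of `z` and `w`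
at `i` and `j` are not used). -/
def chartMatrix {n : ℕ} (i j : Fin n) (z w : Fin n → ℂ) : Matrix (Fin n) (Fin 2) ℂ :=
  fun k => if k = i then ![1, 0] else if k = j then ![0, 1] else ![z k, w k]

/-- The points `((c_{kl} : c'_{kl}))` of the product of projective lines that satisfy
`c'_{kl} z_k w_l = c_{kl} z_l w_k` for all `k < l`, where `z`, `w` are the coordinates in the chart
`M_{ij}` of some point of `W_σ`. -/
def chartParameters {n : ℕ} (i j : Fin n) (σ : Set (Fin n × Fin n)) :
    Set (ChartPair i j → ℙ ℂ (Fin 2 → ℂ)) :=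
  {c | ∃ L ∈ stratum σ, ∃ z w : Fin n → ℂ, L.1 = colSpan (chartMatrix i j z w) ∧
    ∀ p : ChartPair i j,
      (c p).rep 1 * (z p.1.1 * w p.1.2) = (c p).rep 0 * (z p.1.2 * w p.1.1)}

/-- The space of parameters `F_n` of the main stratum (where all Plücker coordinates are non-zero)
as a subset of the product of projective lines, in the chart `M_{ij}`. -/
def mainParameters {n : ℕ} (i j : Fin n) : Set (ChartPair i j → ℙ ℂ (Fin 2 → ℂ)) :=
  chartParameters i j Set.univ

/-- Sections of one line bundle on the product of projective lines which generate the ideal of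
`F̄_S = {c | c_{kl} = c'_{kl} for all k, l ∈ S}`: the sections `c_{kl} - c'_{kl}` of the line
bundles `O(1)` of the single factors, for `k, l ∈ S`, multiplied by all choices of one homogeneous
coordinate in each of the other factors with both indices in `S`. -/
def idealSections {n : ℕ} {i j : Fin n} (S : Finset (Fin n))
    (c : ChartPair i j → ℙ ℂ (Fin 2 → ℂ)) : ChartPair i j × (ChartPair i j → Fin 2) → ℂ :=
  fun q =>
    if q.1.1.1 ∈ S ∧ q.1.1.2 ∈ S then
      ((c q.1).rep 0 - (c q.1).rep 1) *
        ∏ b : ChartPair i j with b ≠ q.1 ∧ b.1.1 ∈ S ∧ b.1.2 ∈ S, (c b).rep (q.2 b)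
    else 0

/-- The projective space in which the blow-up along one `F̄_S` has its fibres. -/
abbrev BlowUpFibre {n : ℕ} (i j : Fin n) : Type :=
  ℙ ℂ (ChartPair i j × (ChartPair i j → Fin 2) → ℂ)

/-- The universal space of parameters, in the chart `M_{ij}`: the wonderful compactification of
`F_n`, with building set the subvarieties `F̄_S`, `|S| ≥ 3`, of the closure `F̄_n` of `F_n` in the
product of projective lines. This is the closure of `F_n` in the product of the blow-ups of `F̄_n`
along all `F̄_S`, each blow-up being the closure of the graph of the map to projective space
defined by generating sections of the ideal. -/
def universalSpace {n : ℕ} (i j : Fin n) :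
    Set ((ChartPair i j → ℙ ℂ (Fin 2 → ℂ)) × (Cluster i j → BlowUpFibre i j)) :=
  closure {x | x.1 ∈ mainParameters i j ∧
    ∀ S : Cluster i j, (x.2 S).submodule = Submodule.span ℂ {idealSections S.1 x.1}}

/-- The virtual space of parameters `F̃_{σ,ij}` of a stratum `W_σ ⊆ M_{ij}`. -/
def virtualSpace {n : ℕ} (i j : Fin n) (σ : Set (Fin n × Fin n)) :
    Set ((ChartPair i j → ℙ ℂ (Fin 2 → ℂ)) × (Cluster i j → BlowUpFibre i j)) :=
  {x | x ∈ universalSpace i j ∧ x.1 ∈ chartParameters i j σ}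

/-! ### Singular points -/

/-- `x = [L]` lies in the chart `M_{ij}`, and the space of parameters `F_σ` of the stratum
`W_σ ∋ L` is not homeomorphic to the virtual space of parameters of `W_σ`, formed in `M_{ij}`. -/
def IsSingularInChart {n : ℕ} (i j : Fin n) (x : OrbitSpace n) : Prop :=
  ∃ L : Gr n, orbitPoint L = x ∧ plucker L i j ≠ 0 ∧
    IsEmpty (ParameterSpace (support L) ≃ₜ virtualSpace i j (support L))

/-- Singular points of the orbit space. The chart in which the virtual space of parameters is
formed is immaterial. -/
def IsSingular {n : ℕ} (x : OrbitSpace n) : Prop :=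
  ∃ i j : Fin n, i < j ∧ IsSingularInChart i j x

end GrassmannTorus

end

/-!
The chart matrix of a plane `L` in `M_{ij}` has rows `(z_k, w_k)`. Call a row generic if both
entries are non-zero; its slope is `x_k = z_k / w_k`. The torus scales all slopes by a common
factor, so `F_n` consists of the ratios of distinct non-zero slopes, and the universal space
consists of limits of these ratios together with the blow-up coordinates, which record the
relative speeds at which slopes collide.

*No zero row and no three parallel rows.* The equations `c'_{kl} z_k w_l = c_{kl} z_l w_k` then
have a unique solution, continuous in `L`, and it lies on no centre `F̄_S`. Hence `F̃_σ` is a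
graph over the set of these solutions, and the ratios of slopes give a continuous inverse `F̃_σ →
F_σ` (`nonempty_homeomorph_of_isSimple`). That the graph lies in the universal space follows by
degenerating the main stratum along explicit curves `x_k = ε ^ d_k (u_k + ε a_k)`
(`limitPoint_mem_universalSpace`); that there is nothing else follows since the proportionality of
blow-up coordinates and sections is a closed condition
(`rep_mul_idealSections_of_mem_universalSpace`).

*A zero row or three parallel rows.* The ratios of slopes embed `F_σ` in `ℂ ^ r`, where `r + 1` is
the number of different slopes of generic rows (`r = 0` if there is none), see
`exists_continuous_injective`. The limits of the curves above provide in `F̃_σ` a continuous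
injective image of an open subset of `ℂ ^ r × ℝ`: besides the slopes, one real parameter is free.
It is the ratio `c_{kl}` of two rows for which the equation is void, if there is a zero row or if
two further rows are parallel to row `i` or to row `j` (`isEmpty_homeomorph_of_free`), and the
ratio of speeds in the collision of three generic rows of equal slope otherwise
(`isEmpty_homeomorph_of_parallel`). By invariance of dimension (`not_injOn_of_finrank_lt`) the two
spaces are not homeomorphic.

Invariance of dimension in this form is deduced from the absence of a smooth retraction of the
ball onto the sphere, which is proved by integrating Jacobian determinants.

Both conditions are independent of the chart, hence so is the notion of a singular point.
-/

noncomputable section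

namespace GrassmannTorus

/-! ### Invariance of dimension -/

section Dimension

open MeasureTheory Metric Set

/-- Interpolation of the polynomial `t ↦ det (1 + t A)` at nodes in `(0, t₀)`; neither the nodes
nor the weights depend on `A`. -/
lemma exists_det_one_add_eq_sum (E : Type*) [NormedAddCommGroup E] [NormedSpace ℝ E]
    [FiniteDimensional ℝ E] {t₀ : ℝ} (ht₀ : 0 < t₀) :
    ∃ τ c : Fin (Module.finrank ℝ E + 1) → ℝ, (∀ m, 0 < τ m ∧ τ m < t₀) ∧ ∑ m, c m = 1 ∧
      ∀ A : E →L[ℝ] E, (1 + A).det = ∑ m, c m * (1 + τ m • A).det := by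
  classical
  let d := Module.finrank ℝ E
  let b := Module.finBasis ℝ E
  let τ : Fin (d + 1) → ℝ := fun m => t₀ * ((m : ℝ) + 1) / (d + 2)
  have hd : (0 : ℝ) < d + 2 := by positivity
  have hτ : Function.Injective τ := by
    intro a b hab
    have h1 : t₀ * ((a : ℝ) + 1) = t₀ * ((b : ℝ) + 1) := by
      simpa [τ, div_left_inj' hd.ne'] using hab
    have h2 := mul_left_cancel₀ ht₀.ne' h1
    exact Fin.ext (by exact_mod_cast (add_right_cancel h2))
  let c : Fin (d + 1) → ℝ := fun m => (Lagrange.basis Finset.univ τ m).eval 1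
  refine ⟨τ, c, fun m => ⟨by positivity, ?_⟩, ?_, fun A => ?_⟩
  · rw [div_lt_iff₀ hd]
    have : ((m : ℕ) : ℝ) + 1 ≤ d + 1 := by exact_mod_cast m.2
    nlinarith
  · have := Lagrange.sum_basis (s := Finset.univ) hτ.injOn Finset.univ_nonempty
    have h2 := congrArg (Polynomial.eval 1) this
    simpa [Polynomial.eval_finsetSum] using h2
  · let M : Matrix (Fin d) (Fin d) ℝ := LinearMap.toMatrix b b (A : E →ₗ[ℝ] E)
    let p : Polynomial ℝ :=
      ((Polynomial.X : Polynomial ℝ) • M.map (Polynomial.C : ℝ →+* Polynomial ℝ) +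
      (1 : Matrix (Fin d) (Fin d) ℝ).map (Polynomial.C : ℝ →+* Polynomial ℝ)).det
    have hp : ∀ t : ℝ, p.eval t = (1 + t • A).det := by
      intro t
      have h1 : p.eval t = (t • M + 1).det := by
        rw [← Polynomial.coe_evalRingHom, RingHom.map_det]
        congr 1
        ext k l
        by_cases hkl : k = l <;> simp [hkl] <;> ring
      rw [h1, ContinuousLinearMap.det, ← LinearMap.det_toMatrix b]
      congr 1
      have h2 : ((1 + t • A : E →L[ℝ] E) : E →ₗ[ℝ] E) = t • (A : E →ₗ[ℝ] E) + LinearMap.id := by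
        ext x : 1; simp [add_comm]
      rw [h2, map_add, map_smul, LinearMap.toMatrix_id]
    have hdeg : p.degree < (Finset.univ : Finset (Fin (d + 1))).card := by
      refine lt_of_le_of_lt Polynomial.degree_le_natDegree ?_
      have := Polynomial.natDegree_det_X_add_C_le M 1
      simp only [Finset.card_univ, Fintype.card_fin] at this ⊢
      exact_mod_cast Nat.lt_succ_of_le this
    have h := Lagrange.eq_interpolate hτ.injOn hdeg
    have h1 := congrArg (Polynomial.eval 1) h
    rw [hp, one_smul, Lagrange.interpolate_apply, Polynomial.eval_finsetSum] at h1
    rw [h1]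
    refine Finset.sum_congr rfl fun m _ => ?_
    rw [Polynomial.eval_mul, Polynomial.eval_C, hp, mul_comm]

lemma lipschitzWith_of_lipschitzOn_closedBall {E : Type*} [NormedAddCommGroup E] [NormedSpace ℝ E]
    {u : E → E} {K : NNReal} (hK : LipschitzOnWith K u (closedBall 0 1))
    (hin : ∀ x, 1 ≤ ‖x‖ → u x = 0) : LipschitzWith K u := by
  have key : ∀ x y : E, ‖x‖ ≤ 1 → 1 ≤ ‖y‖ → dist (u x) (u y) ≤ K * dist x y := by
    intro x y hx hy
    -- the segment from `x` to `y` meets the unit sphere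
    obtain ⟨s, hs, hs1⟩ : ∃ s ∈ Icc (0 : ℝ) 1, ‖AffineMap.lineMap x y s‖ = 1 := by
      have hc : ContinuousOn (fun s : ℝ => ‖AffineMap.lineMap (k := ℝ) x y s‖) (Icc 0 1) :=
        (AffineMap.lineMap_continuous.norm).continuousOn
      have := intermediate_value_Icc zero_le_one hc
      exact this ⟨by simpa using hx, by simpa using hy⟩
    set z := AffineMap.lineMap (k := ℝ) x y s
    rw [hin y hy, ← hin z hs1.ge]
    refine (hK.dist_le_mul x (by simpa using hx) z (by simpa using hs1.le)).trans ?_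
    gcongr
    rw [dist_left_lineMap, Real.norm_of_nonneg hs.1]
    exact mul_le_of_le_one_left dist_nonneg hs.2
  refine LipschitzWith.of_dist_le_mul fun x y => ?_
  rcases le_total ‖x‖ 1 with hx | hx <;> rcases le_total ‖y‖ 1 with hy | hy
  · exact hK.dist_le_mul x (by simpa using hx) y (by simpa using hy)
  · exact key x y hx hy
  · rw [dist_comm, dist_comm x]; exact key y x hy hx
  · rw [hin x hx, hin y hy, dist_self]; positivity

/-- A small Lipschitz perturbation of the identity which moves only points of the unit ball, and
moves them inside the unit ball, is a bijection of the unit ball. -/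
lemma injOn_and_image_closedBall_of_small {E : Type*} [NormedAddCommGroup E] [NormedSpace ℝ E]
    [CompleteSpace E] {u : E → E} {K : NNReal} (hu : LipschitzWith K u)
    (hin : ∀ x, 1 ≤ ‖x‖ → u x = 0) (hmap : ∀ x, ‖x‖ ≤ 1 → ‖x + u x‖ ≤ 1) {t : ℝ} (ht : 0 < t)
    (ht1 : t < 1) (htK : t * K < 1) :
    InjOn (fun x => x + t • u x) (closedBall 0 1) ∧
      (fun x => x + t • u x) '' closedBall 0 1 = closedBall 0 1 := by
  let T : NNReal := ⟨t, ht.le⟩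
  have hT : T * K < 1 := by exact_mod_cast htK
  set g := fun x => x + t • u x
  have hg : ApproximatesLinearOn g ((ContinuousLinearEquiv.refl ℝ E : E ≃L[ℝ] E) : E →L[ℝ] E) univ
      (T * K) := by
    intro x _ y _
    have : g x - g y - ((ContinuousLinearEquiv.refl ℝ E : E ≃L[ℝ] E) : E →L[ℝ] E) (x - y) =
        t • (u x - u y) := by simp [g, smul_sub]; abel
    rw [this, norm_smul, Real.norm_of_nonneg ht.le, NNReal.coe_mul, mul_assoc]
    have := hu.dist_le_mul x y
    rw [dist_eq_norm, dist_eq_norm] at this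
    exact mul_le_mul_of_nonneg_left this ht.le
  have hc : Subsingleton E ∨ T * K <
      ‖((ContinuousLinearEquiv.refl ℝ E).symm : E →L[ℝ] E)‖₊⁻¹ := by
    rcases subsingleton_or_nontrivial E with h | h
    · exact Or.inl h
    · right
      have : ‖((ContinuousLinearEquiv.refl ℝ E).symm : E →L[ℝ] E)‖₊ = 1 := by
        ext; exact ContinuousLinearMap.norm_id
      rw [this, inv_one]; exact hT
  have hinj : Function.Injective g := by
    have := hg.injective hc
    intro x y hxy
    exact congrArg Subtype.val (@this ⟨x, trivial⟩ ⟨y, trivial⟩ hxy)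
  have hsurj : Function.Surjective g := hg.surjective hc
  have hconv : ∀ x, ‖x‖ ≤ 1 → ‖g x‖ ≤ 1 := by
    intro x hx
    have : g x = (1 - t) • x + t • (x + u x) := by simp only [g]; module
    rw [this]
    have := (convex_closedBall (0 : E) 1) (x := x) (by simpa using hx) (y := x + u x)
      (by simpa using hmap x hx) (sub_nonneg.2 ht1.le) ht.le (by ring)
    simpa using this
  refine ⟨hinj.injOn, Subset.antisymm ?_ ?_⟩
  · rintro _ ⟨x, hx, rfl⟩
    simpa using hconv x (by simpa using hx)
  · intro y hy
    obtain ⟨x, rfl⟩ := hsurj y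
    refine ⟨x, ?_, rfl⟩
    by_contra hx
    have hx' : 1 < ‖x‖ := by simpa using hx
    have : g x = x := by simp [g, hin x hx'.le]
    rw [this] at hy
    exact hx hy

/-- There is no `C¹` retraction of the ball onto the sphere. If `r` were one, the volume of the
image of the ball under `id + t (r - id)` would be a polynomial in `t`, constant for small `t`,
hence equal to the volume of the ball at `t = 1`, where the integrand `det (fderiv ℝ r)`
vanishes. -/
lemma no_contDiff_retraction {E : Type*} [NormedAddCommGroup E] [InnerProductSpace ℝ E]
    [FiniteDimensional ℝ E] [MeasurableSpace E] [BorelSpace E] (r : E → E) (hr : ContDiff ℝ 1 r)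
    (hnorm : ∀ x, ‖r x‖ = 1) (hid : ∀ x, ‖x‖ = 1 → r x = x) : False := by
  set B : Set E := closedBall 0 1
  let u : E → E := fun x => r x - x
  have hu : ContDiff ℝ 1 u := hr.sub contDiff_fun_id
  have hBc : IsCompact B := isCompact_closedBall 0 1
  have hcont : Continuous (fderiv ℝ u) := hu.continuous_fderiv one_ne_zero
  obtain ⟨K₀, hK₀⟩ := hBc.exists_bound_of_continuousOn hcont.continuousOn
  set K : NNReal := ⟨max K₀ 1, by positivity⟩
  have hKpos : (1 : ℝ) ≤ K := le_max_right _ _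
  have hK : ∀ x ∈ B, ‖fderiv ℝ u x‖ ≤ K := fun x hx => (hK₀ x hx).trans (le_max_left _ _)
  have hLip : LipschitzOnWith K u B :=
    (convex_closedBall (0 : E) 1).lipschitzOnWith_of_nnnorm_fderiv_le
      (fun x _ => (hu.differentiable one_ne_zero) x) (fun x hx => hK x hx)
  -- `u` vanishes on the sphere, so its extension by zero is Lipschitz on the whole space
  let v : E → E := B.indicator u
  have hv0 : ∀ x, 1 ≤ ‖x‖ → v x = 0 := by
    intro x hx
    rcases hx.eq_or_lt with h | h
    · have : x ∈ B := by simp [B, ← h]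
      simp [v, this, u, hid x h.symm]
    · have : x ∉ B := by simpa [B] using h
      simp [v, this]
  have hvB : EqOn v u B := fun x hx => indicator_of_mem hx u
  have hvLip : LipschitzWith K v :=
    lipschitzWith_of_lipschitzOn_closedBall
      (fun x hx y hy => by rw [hvB hx, hvB hy]; exact hLip hx hy) hv0
  have hvmap : ∀ x, ‖x‖ ≤ 1 → ‖x + v x‖ ≤ 1 := by
    intro x hx
    have : x ∈ B := by simpa [B] using hx
    rw [hvB this]; simp [u, hnorm]
  -- determinants close to the identity are positive
  obtain ⟨δ, hδ, hdet⟩ : ∃ δ > 0, ∀ A : E →L[ℝ] E, ‖A‖ < δ → 0 < (1 + A).det := by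
    have h1 : Continuous fun A : E →L[ℝ] E => (1 + A).det :=
      ContinuousLinearMap.continuous_det.comp (continuous_const.add continuous_id)
    have h2 : 0 < (1 + (0 : E →L[ℝ] E)).det := by
      rw [add_zero]; simp [ContinuousLinearMap.det]
    obtain ⟨δ, hδ, h⟩ := Metric.eventually_nhds_iff.1 (h1.continuousAt.eventually_const_lt h2)
    exact ⟨δ, hδ, fun A hA => h (by simpa using hA)⟩
  have hKp : (0 : ℝ) < K := by linarith
  obtain ⟨τ, c, hτ, hc, hsum⟩ := exists_det_one_add_eq_sum E
    (t₀ := min (1 / K) (δ / K)) (by positivity)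
  have hvol : ∀ m, ∫ x in B, (1 + τ m • fderiv ℝ u x).det = (volume B).toReal := by
    intro m
    obtain ⟨h0, h1⟩ := hτ m
    have hK1 : τ m * K < 1 := by
      rw [← lt_div_iff₀ hKp]; exact h1.trans_le (min_le_left _ _)
    have hKδ : τ m * K < δ := by
      rw [← lt_div_iff₀ hKp]; exact h1.trans_le (min_le_right _ _)
    obtain ⟨hinj, himg⟩ := injOn_and_image_closedBall_of_small hvLip hv0 hvmap h0
      (by nlinarith) hK1
    have heq : EqOn (fun x => x + τ m • v x) (fun x => x + τ m • u x) B :=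
      fun x hx => by simp only [hvB hx]
    have hder : ∀ x ∈ B, HasFDerivWithinAt (fun x => x + τ m • u x)
        (1 + τ m • fderiv ℝ u x) B x := fun x _ =>
      ((hasFDerivAt_id x).add
        (((hu.differentiable one_ne_zero) x).hasFDerivAt.const_smul (τ m))).hasFDerivWithinAt
    have hcv := integral_image_eq_integral_abs_det_fderiv_smul volume
      measurableSet_closedBall hder (hinj.congr heq) (fun _ => (1 : ℝ))
    rw [← heq.image_eq, himg] at hcv
    simp only [smul_eq_mul, mul_one, integral_const, measureReal_restrict_apply_univ] at hcv
    rw [← measureReal_def, hcv]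
    refine setIntegral_congr_fun measurableSet_closedBall fun x hx => ?_
    refine (abs_of_pos (hdet _ ?_)).symm
    rw [norm_smul, Real.norm_of_nonneg h0.le]
    exact (mul_le_mul_of_nonneg_left (hK x hx) h0.le).trans_lt hKδ
  have hint : ∀ m, IntegrableOn (fun x => (1 + τ m • fderiv ℝ u x).det) B volume := by
    intro m
    refine ContinuousOn.integrableOn_compact hBc (Continuous.continuousOn ?_)
    exact ContinuousLinearMap.continuous_det.comp
      (continuous_const.add (hcont.const_smul (τ m)))
  have h1 : ∫ x in B, (1 + fderiv ℝ u x).det = (volume B).toReal := by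
    rw [setIntegral_congr_fun measurableSet_closedBall fun x _ => hsum (fderiv ℝ u x)]
    rw [integral_finsetSum _ fun m _ => (hint m).const_mul (c m)]
    rw [Finset.sum_congr rfl fun m _ => (integral_const_mul (c m) _).trans
      (congrArg (c m * ·) (hvol m)), ← Finset.sum_mul, hc, one_mul]
  have h2 : ∀ x, (1 + fderiv ℝ u x).det = 0 := by
    intro x
    have hd := (hr.differentiable one_ne_zero) x
    have hfd : 1 + fderiv ℝ u x = fderiv ℝ r x := by
      have : fderiv ℝ u x = fderiv ℝ r x - 1 := by
        have h := fderiv_fun_sub hd differentiableAt_fun_id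
        rw [fderiv_fun_id] at h
        exact h
      rw [this]; abel
    rw [hfd]
    by_contra hne
    -- the image of `fderiv ℝ r x` is orthogonal to `r x`
    have horth : ∀ w, inner ℝ (r x) (fderiv ℝ r x w) = 0 := by
      intro w
      have e1 : HasFDerivAt (fun y => inner ℝ (r y) (r y)) _ x :=
        hd.hasFDerivAt.inner ℝ hd.hasFDerivAt
      have e2 : (fun y => inner ℝ (r y) (r y)) = fun _ : E => (1 : ℝ) := by
        funext y; rw [real_inner_self_eq_norm_sq, hnorm]; norm_num
      rw [e2] at e1
      have e3 := congrArg (fun A : E →L[ℝ] ℝ => A w) (e1.unique (hasFDerivAt_const (1 : ℝ) x))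
      simp [real_inner_comm] at e3
      linarith
    have hunit : IsUnit (fderiv ℝ r x : E →ₗ[ℝ] E) :=
      (LinearMap.isUnit_iff_isUnit_det _).2 (isUnit_iff_ne_zero.2 hne)
    obtain ⟨w, hw⟩ := ((Module.End.isUnit_iff _).1 hunit).surjective (r x)
    have := horth w
    rw [show fderiv ℝ r x w = r x from hw, real_inner_self_eq_norm_sq, hnorm] at this
    norm_num at this
  simp only [h2, integral_zero] at h1
  have hpos : 0 < volume B := measure_closedBall_pos volume 0 one_pos
  have hfin : volume B < ⊤ := hBc.measure_lt_top
  exact (ENNReal.toReal_pos hpos.ne' hfin.ne).ne h1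

/-- A continuous self-map of Euclidean space which is close to the identity on the unit ball has a
zero there. -/
lemma exists_eq_zero_of_near_id {E : Type*} [NormedAddCommGroup E] [InnerProductSpace ℝ E]
    [FiniteDimensional ℝ E] (h : E → E) (hc : ContinuousOn h (closedBall 0 1))
    (hh : ∀ x ∈ closedBall 0 1, ‖h x - x‖ ≤ 1 / 2) : ∃ x ∈ closedBall 0 1, h x = 0 := by
  by_contra! hne
  borelize E
  set B : Set E := closedBall 0 1
  have hBc : IsCompact B := isCompact_closedBall 0 1
  obtain ⟨w, hw⟩ : ∃ w : C(E, E), EqOn w (fun x => h x - x) B := by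
    obtain ⟨w, hw⟩ := ContinuousMap.exists_restrict_eq (Y := E) (s := B)
      isClosed_closedBall ⟨B.domRestrict fun x => h x - x,
        (hc.sub continuousOn_id).domRestrict⟩
    exact ⟨w, fun x hx => congrArg (fun f : C(B, E) => f ⟨x, hx⟩) hw⟩
  obtain ⟨η, hη, hmin⟩ : ∃ η > 0, ∀ x ∈ B, η ≤ ‖h x‖ := by
    obtain ⟨x₀, hx₀, hmin⟩ := hBc.exists_isMinOn ⟨0, by simp [B]⟩ hc.norm
    exact ⟨‖h x₀‖, norm_pos_iff.2 (hne x₀ hx₀), fun x hx => hmin hx⟩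
  obtain ⟨g, hg, hgw, -⟩ := w.continuous.exists_contDiff_approx 1
    (ε := fun _ => min (η / 2) (1 / 8))
    continuous_const (fun _ => by positivity)
  let χ : ContDiffBump (0 : E) := ⟨3 / 4, 7 / 8, by norm_num, by norm_num⟩
  -- `F` has no zeros and is the identity near the sphere, so `F / ‖F‖` is a retraction
  let F : E → E := fun x => x + χ x • g x
  have hF : ContDiff ℝ 1 F := contDiff_id.add (χ.contDiff.smul hg)
  have hg1 : ∀ x ∈ B, ‖g x‖ ≤ 5 / 8 := by
    intro x hx
    have h1 := (hgw x).trans_le (min_le_right _ _)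
    rw [dist_eq_norm] at h1
    have h2 : ‖w x‖ ≤ 1 / 2 := by rw [hw hx]; exact hh x hx
    have := norm_sub_norm_le (g x) (w x)
    linarith
  have hFout : ∀ x, 7 / 8 ≤ ‖x‖ → F x = x := by
    intro x hx
    have : χ x = 0 := χ.zero_of_le_dist (by simpa using hx)
    simp [F, this]
  have hF0 : ∀ x, F x ≠ 0 := by
    intro x hx0
    rcases le_total ‖x‖ (3 / 4) with hx | hx
    · have hxB : x ∈ B := by simp only [B, mem_closedBall_zero_iff]; linarith
      have h1 : χ x = 1 := χ.one_of_mem_closedBall (by simpa using hx)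
      have h2 := (hgw x).trans_le (min_le_left _ _)
      rw [dist_eq_norm, hw hxB] at h2
      have h3 : g x - (h x - x) = - h x := by
        simp only [F, h1, one_smul] at hx0
        rw [eq_neg_of_add_eq_zero_right hx0]; abel
      rw [h3, norm_neg] at h2
      have := hmin x hxB
      linarith
    · rcases le_total (7 / 8) ‖x‖ with hx' | hx'
      · rw [hFout x hx'] at hx0
        rw [hx0, norm_zero] at hx'
        norm_num at hx'
      · have hxB : x ∈ B := by simp only [B, mem_closedBall_zero_iff]; linarith
        have h1 : ‖χ x • g x‖ ≤ 5 / 8 := by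
          rw [norm_smul, Real.norm_of_nonneg χ.nonneg]
          exact (mul_le_of_le_one_left (norm_nonneg _) χ.le_one).trans (hg1 x hxB)
        have h2 : x = - (χ x • g x) := eq_neg_of_add_eq_zero_left hx0
        rw [← norm_neg, ← h2] at h1
        linarith
  refine no_contDiff_retraction (fun x => ‖F x‖⁻¹ • F x) ?_ ?_ ?_
  · exact ((hF.norm ℝ hF0).inv fun x => norm_ne_zero_iff.2 (hF0 x)).smul hF
  · intro x
    rw [norm_smul, norm_inv, norm_norm, inv_mul_cancel₀ (norm_ne_zero_iff.2 (hF0 x))]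
  · intro x hx
    simp only [hFout x (by rw [hx]; norm_num), hx, inv_one, one_smul]

/-- **Invariance of dimension**: a non-empty open subset of a real vector space does not inject
continuously into a vector space of smaller dimension. If `f` were such an injection, a smooth
approximation of its inverse composed with `f` would be near the identity of a ball, while the
range of a smooth map into a space of larger dimension omits points arbitrarily near to any given
one. -/
theorem not_injOn_of_finrank_lt {V W : Type*} [NormedAddCommGroup V] [NormedSpace ℝ V]
    [FiniteDimensional ℝ V] [NormedAddCommGroup W] [NormedSpace ℝ W] [FiniteDimensional ℝ W]
    (hlt : Module.finrank ℝ W < Module.finrank ℝ V) {D : Set V} (hD : IsOpen D)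
    (hne : D.Nonempty) {f : V → W} (hf : ContinuousOn f D) : ¬ InjOn f D := by
  intro hinj
  obtain ⟨x₀, hx₀⟩ := hne
  let E := EuclideanSpace ℝ (Fin (Module.finrank ℝ V))
  let e : E ≃L[ℝ] V := ContinuousLinearEquiv.ofFinrankEq (by simp [E])
  set B : Set E := closedBall 0 1
  have hBc : IsCompact B := isCompact_closedBall 0 1
  obtain ⟨ρ, hρ, hball⟩ : ∃ ρ : ℝ, 0 < ρ ∧ ∀ x ∈ B, x₀ + ρ • e x ∈ D := by
    obtain ⟨ε, hε, hsub⟩ := Metric.isOpen_iff.1 hD x₀ hx₀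
    obtain ⟨C, hC⟩ := hBc.exists_bound_of_continuousOn e.continuous.continuousOn
    refine ⟨ε / (|C| + 1), by positivity, fun x hx => hsub ?_⟩
    rw [mem_ball_iff_norm, add_sub_cancel_left, norm_smul, Real.norm_of_nonneg (by positivity),
      div_mul_eq_mul_div, div_lt_iff₀ (by positivity)]
    have := (hC x hx).trans (le_abs_self C)
    nlinarith
  let φ : E → W := fun x => f (x₀ + ρ • e x)
  have hφ : ContinuousOn φ B :=
    hf.comp (continuous_const.add (e.continuous.const_smul ρ)).continuousOn hball
  have hφinj : InjOn φ B := by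
    intro x hx y hy hxy
    have := hinj (hball x hx) (hball y hy) hxy
    exact e.injective (smul_right_injective V hρ.ne' (add_left_cancel this))
  have hemb : Topology.IsClosedEmbedding (B.domRestrict φ) := by
    have : CompactSpace B := isCompact_iff_compactSpace.1 hBc
    exact hφ.domRestrict.isClosedEmbedding ((injOn_iff_injective).1 hφinj)
  obtain ⟨G, hG⟩ := ContinuousMap.exists_extension (Y := E) hemb
    ⟨Subtype.val, continuous_subtype_val⟩
  have hG' : ∀ x ∈ B, G (φ x) = x := fun x hx =>
    congrArg (fun k : C(B, E) => k ⟨x, hx⟩) hG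
  obtain ⟨P, hP, hPG, -⟩ := G.continuous.exists_contDiff_approx 1 (ε := fun _ => 1 / 4)
    continuous_const (fun _ => by norm_num)
  have hdense : Dense (range P)ᶜ :=
    hP.dense_compl_range_of_finrank_lt_finrank (by simpa [E] using hlt)
  obtain ⟨y, hyP, hy⟩ := hdense.exists_mem_open (isOpen_ball (x := (0 : E)) (ε := 1 / 4))
    ⟨0, by simp⟩
  obtain ⟨x, hx, hx0⟩ := exists_eq_zero_of_near_id (fun x => P (φ x) - y)
    ((hP.continuous.comp_continuousOn hφ).sub continuousOn_const) (by
      intro x hx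
      have h1 := hPG (φ x)
      rw [hG' x hx, dist_eq_norm] at h1
      have h2 : ‖y‖ < 1 / 4 := by simpa using hy
      calc ‖P (φ x) - y - x‖ = ‖(P (φ x) - x) - y‖ := by congr 1; abel
        _ ≤ ‖P (φ x) - x‖ + ‖y‖ := norm_sub_le _ _
        _ ≤ 1 / 2 := by linarith)
  exact hyP ⟨φ x, sub_eq_zero.1 hx0⟩

end Dimension

/-! ### Topology of complex projective spaces -/

section ProjectiveSpace

variable {ι : Type}

lemma isQuotientMap_projMk : Topology.IsQuotientMap
    (fun v : {v : ι → ℂ // v ≠ 0} => Projectivization.mk ℂ v.1 v.2) :=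
  ⟨⟨rfl⟩, fun p => ⟨⟨p.rep, p.rep_nonzero⟩, p.mk_rep⟩⟩

lemma continuous_projMk {X : Type*} [TopologicalSpace X] {v : X → ι → ℂ} (hv : Continuous v)
    (h0 : ∀ x, v x ≠ 0) : Continuous fun x => Projectivization.mk ℂ (v x) (h0 x) :=
  isQuotientMap_projMk.continuous.comp (hv.subtype_mk h0)

lemma exists_rep_mk_eq (v : ι → ℂ) (hv : v ≠ 0) :
    ∃ c : ℂ, c ≠ 0 ∧ ∀ a, (Projectivization.mk ℂ v hv).rep a = c * v a := by
  obtain ⟨c, hc⟩ := Projectivization.exists_smul_eq_mk_rep ℂ v hv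
  exact ⟨c, c.ne_zero, fun a => by rw [← hc]; rfl⟩

lemma rep_mk_ne_zero_iff (v : ι → ℂ) (hv : v ≠ 0) (a : ι) :
    (Projectivization.mk ℂ v hv).rep a ≠ 0 ↔ v a ≠ 0 := by
  obtain ⟨c, hc, h⟩ := exists_rep_mk_eq v hv
  simp [h, hc]

lemma rep_mk_div (v : ι → ℂ) (hv : v ≠ 0) (a b : ι) :
    (Projectivization.mk ℂ v hv).rep b / (Projectivization.mk ℂ v hv).rep a = v b / v a := by
  obtain ⟨c, hc, h⟩ := exists_rep_mk_eq v hv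
  rw [h, h, mul_div_mul_left _ _ hc]

lemma exists_rep_ne_zero (p : ℙ ℂ (ι → ℂ)) : ∃ a, p.rep a ≠ 0 :=
  Function.ne_iff.1 p.rep_nonzero

lemma isOpen_rep_ne_zero (a : ι) : IsOpen {p : ℙ ℂ (ι → ℂ) | p.rep a ≠ 0} := by
  rw [← isQuotientMap_projMk.isOpen_preimage]
  have : (fun v : {v : ι → ℂ // v ≠ 0} => Projectivization.mk ℂ v.1 v.2) ⁻¹' {p | p.rep a ≠ 0} =
      {v | v.1 a ≠ 0} := by
    ext v
    exact rep_mk_ne_zero_iff v.1 v.2 a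
  rw [this]
  exact isOpen_ne_fun ((continuous_apply a).comp continuous_subtype_val) continuous_const

lemma continuousOn_rep_div (a b : ι) :
    ContinuousOn (fun p : ℙ ℂ (ι → ℂ) => p.rep b / p.rep a) {p | p.rep a ≠ 0} := by
  refine (isQuotientMap_projMk.continuousOn_isOpen_iff (isOpen_rep_ne_zero a)).2 ?_
  have h1 : ∀ v : {v : ι → ℂ // v ≠ 0}, ((fun p : ℙ ℂ (ι → ℂ) => p.rep b / p.rep a) ∘
      fun v : {v : ι → ℂ // v ≠ 0} => Projectivization.mk ℂ v.1 v.2) v = v.1 b / v.1 a :=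
    fun v => rep_mk_div v.1 v.2 a b
  refine ContinuousOn.congr (f := fun v : {v : ι → ℂ // v ≠ 0} => v.1 b / v.1 a) ?_ fun v _ => h1 v
  refine ContinuousOn.div ?_ ?_ fun v hv => (rep_mk_ne_zero_iff v.1 v.2 a).1 hv
  · exact ((continuous_apply b).comp continuous_subtype_val).continuousOn
  · exact ((continuous_apply a).comp continuous_subtype_val).continuousOn

lemma projMk_eq_of_mul_eq {p : ℙ ℂ (ι → ℂ)} {v : ι → ℂ} (hv : v ≠ 0)
    (h : ∀ a b, p.rep a * v b = p.rep b * v a) : p = Projectivization.mk ℂ v hv := by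
  obtain ⟨b, hb⟩ := Function.ne_iff.1 hv
  have hb : v b ≠ 0 := hb
  have hb' : p.rep b ≠ 0 := by
    intro h0
    obtain ⟨a, ha⟩ := exists_rep_ne_zero p
    have := h a b
    rw [h0, zero_mul] at this
    exact (mul_ne_zero ha hb) this
  conv_lhs => rw [← p.mk_rep]
  rw [Projectivization.mk_eq_mk_iff' ℂ _ _ p.rep_nonzero hv]
  refine ⟨p.rep b / v b, ?_⟩
  funext a
  simp only [Pi.smul_apply, smul_eq_mul]
  rw [div_mul_eq_mul_div, div_eq_iff hb, h a b]

lemma projMk_eq_projMk {v v' : ι → ℂ} (hv : v ≠ 0) (hv' : v' ≠ 0) {c : ℂ} (h : v = c • v') :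
    Projectivization.mk ℂ v hv = Projectivization.mk ℂ v' hv' :=
  (Projectivization.mk_eq_mk_iff' ℂ _ _ hv hv').2 ⟨c, h.symm⟩

end ProjectiveSpace

lemma eq_of_mem_closure {X Y : Type*} [TopologicalSpace X] [TopologicalSpace Y] [T2Space Y]
    {s U : Set X} {x : X} (hx : x ∈ closure s) (hU : U ∈ nhds x) {f g : X → Y}
    (hf : ContinuousAt f x) (hg : ContinuousAt g x) (h : ∀ y ∈ s ∩ U, f y = g y) : f x = g x := by
  have hne : Filter.NeBot (nhdsWithin x (s ∩ U : Set X)) := by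
    rw [← mem_closure_iff_nhdsWithin_neBot]
    exact mem_closure_iff_nhds.2 fun t ht => by
      obtain ⟨y, hy⟩ := mem_closure_iff_nhds.1 hx (t ∩ U) (Filter.inter_mem ht hU)
      exact ⟨y, hy.1.1, hy.2, hy.1.2⟩
  refine tendsto_nhds_unique (l := nhdsWithin x (s ∩ U)) (hf.mono_left nhdsWithin_le_nhds)
    ((hg.mono_left nhdsWithin_le_nhds).congr' ?_)
  filter_upwards [self_mem_nhdsWithin] with y hy using (h y hy).symm

/-! ### Plücker coordinates and charts of the Grassmannian -/

section Grassmannian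

variable {n : ℕ}

lemma minor_mul (A : Matrix (Fin n) (Fin 2) ℂ) (g : Matrix (Fin 2) (Fin 2) ℂ) (k l : Fin n) :
    minor (A * g) k l = g.det * minor A k l := by
  simp only [minor, Matrix.mul_apply, Fin.sum_univ_two, Matrix.det_fin_two]
  ring

lemma finrank_colSpan_iff (A : Matrix (Fin n) (Fin 2) ℂ) :
    Module.finrank ℂ (colSpan A) = 2 ↔ ∃ k l, minor A k l ≠ 0 := by
  have h := linearIndependent_iff_card_eq_finrank_span (R := ℂ)
    (b := fun a : Fin 2 => fun k : Fin n => A k a)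
  rw [Fintype.card_fin] at h
  rw [eq_comm]
  refine h.symm.trans ?_
  have hpair : (fun a : Fin 2 => fun k : Fin n => A k a) = ![fun k => A k 0, fun k => A k 1] := by
    funext a
    fin_cases a <;> rfl
  rw [hpair, LinearIndependent.pair_iff]
  constructor
  · intro hli
    by_contra! h0
    have h1 : ∀ k, A k 0 = 0 := by
      intro k
      have := hli (-A k 1) (A k 0) (by
        funext l
        have := h0 k l
        simp only [minor] at this
        simp only [Pi.add_apply, Pi.smul_apply, smul_eq_mul, Pi.zero_apply]
        linear_combination this)
      exact this.2
    have := hli 1 0 (by funext l; simp [h1])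
    exact one_ne_zero this.1
  · rintro ⟨k, l, hkl⟩ s t hst
    have hk := congrFun hst k
    have hl := congrFun hst l
    simp only [Pi.add_apply, Pi.smul_apply, smul_eq_mul, Pi.zero_apply] at hk hl
    constructor
    · refine (mul_eq_zero.1 ?_).resolve_right hkl
      simp only [minor]
      linear_combination A l 1 * hk - A k 1 * hl
    · refine (mul_eq_zero.1 ?_).resolve_right hkl
      simp only [minor]
      linear_combination A k 0 * hl - A l 0 * hk

lemma exists_mul_eq_of_colSpan_le {A B : Matrix (Fin n) (Fin 2) ℂ} (h : colSpan A ≤ colSpan B) :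
    ∃ g : Matrix (Fin 2) (Fin 2) ℂ, A = B * g := by
  have h1 : ∀ a : Fin 2, ∃ c : Fin 2 → ℂ, ∑ b, c b • (fun k : Fin n => B k b) = fun k => A k a := by
    intro a
    exact (Submodule.mem_span_range_iff_exists_fun ℂ).1 (h (Submodule.subset_span ⟨a, rfl⟩))
  choose c hc using h1
  refine ⟨Matrix.of fun b a => c a b, ?_⟩
  ext k a
  refine (congrFun (hc a) k).symm.trans (Eq.trans ?_ (Matrix.mul_apply ..).symm)
  simp [mul_comm]

lemma colSpan_mul_le (B : Matrix (Fin n) (Fin 2) ℂ) (g : Matrix (Fin 2) (Fin 2) ℂ) :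
    colSpan (B * g) ≤ colSpan B := by
  refine Submodule.span_le.2 ?_
  rintro _ ⟨a, rfl⟩
  refine (Submodule.mem_span_range_iff_exists_fun ℂ).2 ⟨fun b => g b a, ?_⟩
  funext k
  refine Eq.trans ?_ (Matrix.mul_apply ..).symm
  simp [mul_comm]

lemma colSpan_frame (L : Gr n) : colSpan (frame L) = L.1 := by
  have h := (Module.finBasisOfFinrankEq ℂ L.1 L.2).span_eq
  have h2 := congrArg (Submodule.map L.1.subtype) h
  rw [Submodule.map_span, Submodule.map_top, Submodule.range_subtype, ← Set.range_comp] at h2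
  exact h2

lemma exists_plucker_eq {L : Gr n} {A : Matrix (Fin n) (Fin 2) ℂ} (h : L.1 = colSpan A) :
    ∃ c : ℂ, c ≠ 0 ∧ ∀ k l, plucker L k l = c * minor A k l := by
  obtain ⟨g, hg⟩ := exists_mul_eq_of_colSpan_le (A := frame L) (B := A)
    (by rw [colSpan_frame, h])
  have h1 : ∀ k l, plucker L k l = g.det * minor A k l := fun k l => by
    rw [plucker, hg, minor_mul]
  refine ⟨g.det, fun h0 => ?_, h1⟩
  obtain ⟨k, l, hkl⟩ := (finrank_colSpan_iff (frame L)).1 (by rw [colSpan_frame]; exact L.2)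
  exact hkl (by rw [← plucker, h1, h0, zero_mul])

lemma plucker_swap (L : Gr n) (k l : Fin n) : plucker L k l = - plucker L l k := by
  simp only [plucker, minor]; ring

lemma minor_chartMatrix_base {i j : Fin n} (hij : i ≠ j) (z w : Fin n → ℂ) :
    minor (chartMatrix i j z w) i j = 1 := by
  simp [minor, chartMatrix, hij.symm]

/-- The point of the chart `M_{ij}` with coordinates `z`, `w`. -/
def chartPoint {i j : Fin n} (hij : i ≠ j) (z w : Fin n → ℂ) : Gr n :=
  ⟨colSpan (chartMatrix i j z w), (finrank_colSpan_iff _).2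
    ⟨i, j, by rw [minor_chartMatrix_base hij]; exact one_ne_zero⟩⟩

/-- The first chart coordinate `z_k` of `L`, as a ratio of Plücker coordinates. -/
def zCoord (i j : Fin n) (L : Gr n) (k : Fin n) : ℂ := plucker L k j / plucker L i j

/-- The second chart coordinate `w_k` of `L`, as a ratio of Plücker coordinates. -/
def wCoord (i j : Fin n) (L : Gr n) (k : Fin n) : ℂ := plucker L i k / plucker L i j

lemma ne_of_plucker_ne_zero {i j : Fin n} {L : Gr n} (h : plucker L i j ≠ 0) : i ≠ j := by
  rintro rfl
  exact h (by simp [plucker, minor]; ring)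

lemma chartPoint_coord {i j : Fin n} (hij : i ≠ j) {L : Gr n} (h : plucker L i j ≠ 0) :
    chartPoint hij (zCoord i j L) (wCoord i j L) = L := by
  symm
  apply Subtype.ext
  have hle : L.1 ≤ colSpan (chartMatrix i j (zCoord i j L) (wCoord i j L)) := by
    rw [← colSpan_frame L]
    have : frame L = chartMatrix i j (zCoord i j L) (wCoord i j L) *
        Matrix.of ![frame L i, frame L j] := by
      ext k a
      rw [Matrix.mul_apply, Fin.sum_univ_two]
      by_cases hki : k = i
      · subst hki; simp [chartMatrix]
      by_cases hkj : k = j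
      · subst hkj; simp [chartMatrix, hki]
      have hA : ∀ b, chartMatrix i j (zCoord i j L) (wCoord i j L) k b =
        ![zCoord i j L k, wCoord i j L k] b := fun b => by simp [chartMatrix, hki, hkj]
      rw [hA, hA]
      simp only [zCoord, wCoord, Matrix.cons_val_zero, Matrix.cons_val_one]
      field_simp
      simp only [plucker, minor]
      fin_cases a <;> simp <;> ring
    rw [this]
    exact colSpan_mul_le _ _
  exact Submodule.eq_of_le_of_finrank_eq hle
    (L.2.trans (chartPoint hij (zCoord i j L) (wCoord i j L)).2.symm)

variable {i j : Fin n}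

lemma plucker_ne_zero_of_eq_colSpan (hij : i ≠ j) {L : Gr n} {z w : Fin n → ℂ}
    (h : L.1 = colSpan (chartMatrix i j z w)) : plucker L i j ≠ 0 := by
  obtain ⟨c, hc, hp⟩ := exists_plucker_eq h
  rw [hp, minor_chartMatrix_base hij, mul_one]; exact hc

lemma coord_eq_of_eq_colSpan (hij : i ≠ j) {L : Gr n} {z w : Fin n → ℂ}
    (h : L.1 = colSpan (chartMatrix i j z w)) {k : Fin n} (hki : k ≠ i) (hkj : k ≠ j) :
    zCoord i j L k = z k ∧ wCoord i j L k = w k := by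
  obtain ⟨c, hc, hp⟩ := exists_plucker_eq h
  rw [zCoord, wCoord, hp, hp, hp, minor_chartMatrix_base hij, mul_one, mul_div_cancel_left₀ _ hc,
    mul_div_cancel_left₀ _ hc]
  simp [minor, chartMatrix, hki, hkj, hij.symm]

/-- The Plücker relation expressing all Plücker coordinates by those of the chart. -/
lemma plucker_eq_coord {L : Gr n} (h : plucker L i j ≠ 0) (k l : Fin n) :
    plucker L k l = plucker L i j *
      (zCoord i j L k * wCoord i j L l - wCoord i j L k * zCoord i j L l) := by
  simp only [zCoord, wCoord]
  field_simp
  simp only [plucker, minor]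
  ring

/-! ### Topology of the Grassmannian -/

/-- The plane spanned by the columns of a matrix of rank two. -/
def Frames.span (A : Frames n) : Gr n := ⟨colSpan A.1, A.2⟩

lemma isQuotientMap_span : Topology.IsQuotientMap (Frames.span (n := n)) :=
  ⟨⟨rfl⟩, fun L => ⟨⟨frame L, by rw [colSpan_frame]; exact L.2⟩, Subtype.ext (colSpan_frame L)⟩⟩

lemma continuous_chartPoint (hij : i ≠ j) {X : Type*} [TopologicalSpace X] {z w : X → Fin n → ℂ}
    (hz : Continuous z) (hw : Continuous w) : Continuous fun x => chartPoint hij (z x) (w x) := by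
  have hA : Continuous fun x => chartMatrix i j (z x) (w x) := by
    refine continuous_matrix fun k a => ?_
    have hzk : Continuous fun x => z x k := (continuous_apply k).comp hz
    have hwk : Continuous fun x => w x k := (continuous_apply k).comp hw
    unfold chartMatrix
    split_ifs
    · exact continuous_const
    · exact continuous_const
    · fin_cases a
      · exact hzk
      · exact hwk
  have hF : Continuous fun x =>
      (⟨chartMatrix i j (z x) (w x), (chartPoint hij (z x) (w x)).2⟩ : Frames n) :=
    hA.subtype_mk _
  exact (isQuotientMap_span.continuous.comp hF).congr fun x => Subtype.ext rfl

lemma plucker_span_div (A : Frames n) (k l k' l' : Fin n) :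
    plucker A.span k l / plucker A.span k' l' =
      minor A.1 k l / minor A.1 k' l' := by
  obtain ⟨c, hc, hp⟩ := exists_plucker_eq (L := A.span) (A := A.1) rfl
  rw [hp, hp, mul_div_mul_left _ _ hc]

lemma plucker_span_ne_zero_iff (A : Frames n) (k l : Fin n) :
    plucker A.span k l ≠ 0 ↔ minor A.1 k l ≠ 0 := by
  obtain ⟨c, hc, hp⟩ := exists_plucker_eq (L := A.span) (A := A.1) rfl
  rw [hp]; simp [hc]

lemma continuous_minor (k l : Fin n) : Continuous fun A : Frames n => minor A.1 k l := by
  have h : ∀ (k : Fin n) (a : Fin 2), Continuous fun A : Frames n => A.1 k a := fun k a =>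
    (continuous_apply a).comp ((continuous_apply k).comp continuous_subtype_val)
  exact ((h k 0).mul (h l 1)).sub ((h k 1).mul (h l 0))

lemma isOpen_plucker_ne_zero (k l : Fin n) : IsOpen {L : Gr n | plucker L k l ≠ 0} := by
  rw [← isQuotientMap_span.isOpen_preimage]
  have : Frames.span ⁻¹' {L | plucker L k l ≠ 0} =
      {A | minor A.1 k l ≠ 0} := Set.ext fun A => plucker_span_ne_zero_iff A k l
  rw [this]
  exact isOpen_ne_fun (continuous_minor k l) continuous_const

lemma continuousOn_plucker_div (k l k' l' : Fin n) :
    ContinuousOn (fun L : Gr n => plucker L k l / plucker L k' l') {L | plucker L k' l' ≠ 0} := by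
  refine (isQuotientMap_span.continuousOn_isOpen_iff (isOpen_plucker_ne_zero k' l')).2 ?_
  refine ContinuousOn.congr (f := fun A : Frames n => minor A.1 k l / minor A.1 k' l') ?_
    fun A _ => plucker_span_div A k l k' l'
  exact (continuous_minor k l).continuousOn.div (continuous_minor k' l').continuousOn
    fun A hA => (plucker_span_ne_zero_iff A k' l').1 hA

/-! ### Torus orbits in a chart -/

lemma exists_plucker_smul (t : Fin n → ℂˣ) (L : Gr n) :
    ∃ c : ℂ, c ≠ 0 ∧ ∀ k l, plucker (t • L) k l = c * (t k * t l * plucker L k l) := by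
  have h : (t • L).1 = colSpan (fun k a => (t k : ℂ) * frame L k a) := by
    change L.1.map (torusEquiv t).toLinearMap = _
    rw [← colSpan_frame L, colSpan, Submodule.map_span, ← Set.range_comp]
    rfl
  obtain ⟨c, hc, hp⟩ := exists_plucker_eq h
  refine ⟨c, hc, fun k l => ?_⟩
  rw [hp, plucker]
  simp only [minor]
  ring

lemma support_smul (t : Fin n → ℂˣ) (L : Gr n) : support (t • L) = support L := by
  obtain ⟨c, hc, h⟩ := exists_plucker_smul t L
  ext p
  simp [support, h, hc]

lemma smul_chartPoint_eq (hij : i ≠ j) {z w z' w' : Fin n → ℂ} (t : Fin n → ℂˣ)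
    (hz : ∀ k, k ≠ i → k ≠ j → z' k * t i = t k * z k)
    (hw : ∀ k, k ≠ i → k ≠ j → w' k * t j = t k * w k) :
    t • chartPoint hij z w = chartPoint hij z' w' := by
  apply Subtype.ext
  have h1 : (t • chartPoint hij z w).1 =
      colSpan (fun k a => (t k : ℂ) * chartMatrix i j z w k a) := by
    change (colSpan (chartMatrix i j z w)).map (torusEquiv t).toLinearMap = _
    rw [colSpan, Submodule.map_span, ← Set.range_comp]
    rfl
  refine Submodule.eq_of_le_of_finrank_eq ?_
    ((t • chartPoint hij z w).2.trans (chartPoint hij z' w').2.symm)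
  rw [h1]
  have : (fun k a => (t k : ℂ) * chartMatrix i j z w k a) =
      chartMatrix i j z' w' * Matrix.diagonal ![(t i : ℂ), (t j : ℂ)] := by
    ext k a
    rw [Matrix.mul_diagonal]
    by_cases hki : k = i
    · subst hki
      fin_cases a <;> simp [chartMatrix]
    by_cases hkj : k = j
    · subst hkj
      fin_cases a <;> simp [chartMatrix, hki]
    fin_cases a
    · simpa [chartMatrix, hki, hkj] using (hz k hki hkj).symm
    · simpa [chartMatrix, hki, hkj] using (hw k hki hkj).symm
  rw [show colSpan (fun k a => (t k : ℂ) * chartMatrix i j z w k a) = colSpan _ from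
    congrArg colSpan this]
  exact colSpan_mul_le _ _

end Grassmannian

/-! ### Sections of the ideals of the centres of the blow-ups -/

section Sections

variable {n : ℕ} {i j : Fin n}

/-- The space in which the universal space of parameters is formed. -/
abbrev Ambient {n : ℕ} (i j : Fin n) : Type :=
  (ChartPair i j → ℙ ℂ (Fin 2 → ℂ)) × (Cluster i j → BlowUpFibre i j)

lemma exists_chartPair {k l : Fin n} (hk : k ≠ i ∧ k ≠ j) (hl : l ≠ i ∧ l ≠ j) (hkl : k ≠ l) :
    (∃ p : ChartPair i j, p.1 = (k, l)) ∨ ∃ p : ChartPair i j, p.1 = (l, k) := by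
  rcases lt_or_gt_of_ne hkl with h | h
  · exact Or.inl ⟨⟨(k, l), h, hk.1, hk.2, hl.1, hl.2⟩, rfl⟩
  · exact Or.inr ⟨⟨(l, k), h, hl.1, hl.2, hk.1, hk.2⟩, rfl⟩

lemma Cluster.ne_of_mem (S : Cluster i j) {k : Fin n} (hk : k ∈ S.1) : k ≠ i ∧ k ≠ j :=
  ⟨fun h => S.2.1 (h ▸ hk), fun h => S.2.2.1 (h ▸ hk)⟩

/-- The sections `idealSections`, evaluated at arbitrary homogeneous coordinates. -/
def sections (S : Finset (Fin n)) (v : ChartPair i j → Fin 2 → ℂ) :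
    ChartPair i j × (ChartPair i j → Fin 2) → ℂ :=
  fun q =>
    if q.1.1.1 ∈ S ∧ q.1.1.2 ∈ S then
      (v q.1 0 - v q.1 1) * ∏ b : ChartPair i j with b ≠ q.1 ∧ b.1.1 ∈ S ∧ b.1.2 ∈ S, v b (q.2 b)
    else 0

lemma idealSections_eq (S : Finset (Fin n)) (c : ChartPair i j → ℙ ℂ (Fin 2 → ℂ)) :
    idealSections S c = sections S fun p => (c p).rep := rfl

lemma sections_smul (S : Finset (Fin n)) (v : ChartPair i j → Fin 2 → ℂ)
    (r : ChartPair i j → ℂ) : sections S (fun p => r p • v p) =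
      (∏ b : ChartPair i j with b.1.1 ∈ S ∧ b.1.2 ∈ S, r b) • sections S v := by
  funext q
  simp only [sections, Pi.smul_apply, smul_eq_mul]
  split_ifs with h
  · have h1 : (Finset.univ.filter fun b : ChartPair i j => b.1.1 ∈ S ∧ b.1.2 ∈ S) =
        insert q.1 (Finset.univ.filter fun b : ChartPair i j =>
          b ≠ q.1 ∧ b.1.1 ∈ S ∧ b.1.2 ∈ S) := by
      ext b
      simp only [Finset.mem_filter, Finset.mem_univ, true_and, Finset.mem_insert]
      by_cases hb : b = q.1
      · simp [hb, h]
      · simp [hb]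
    rw [h1, Finset.prod_insert (by simp), Finset.prod_mul_distrib]
    ring
  · simp

lemma span_idealSections_mk (S : Finset (Fin n)) (v : ChartPair i j → Fin 2 → ℂ)
    (hv : ∀ p, v p ≠ 0) :
    ∃ c : ℂ, c ≠ 0 ∧ idealSections S (fun p => Projectivization.mk ℂ (v p) (hv p)) =
      c • sections S v := by
  choose r hr h using fun p => exists_rep_mk_eq (v p) (hv p)
  refine ⟨∏ b : ChartPair i j with b.1.1 ∈ S ∧ b.1.2 ∈ S, r b,
    Finset.prod_ne_zero_iff.2 fun b _ => hr b, ?_⟩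
  rw [← sections_smul, idealSections_eq]
  congr 1
  funext p a
  exact h p a

lemma exists_prod_ne_zero {v : ChartPair i j → Fin 2 → ℂ} (hv : ∀ p, v p ≠ 0) :
    ∃ η : ChartPair i j → Fin 2, ∀ s : Finset (ChartPair i j), ∏ b ∈ s, v b (η b) ≠ 0 := by
  choose η hη using fun p => Function.ne_iff.1 (hv p)
  exact ⟨η, fun s => Finset.prod_ne_zero_iff.2 fun b _ => hη b⟩

lemma sections_ne_zero {S : Finset (Fin n)} {v : ChartPair i j → Fin 2 → ℂ}
    (hv : ∀ p, v p ≠ 0) {p : ChartPair i j} (h1 : p.1.1 ∈ S) (h2 : p.1.2 ∈ S)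
    (hp : v p 0 ≠ v p 1) : sections S v ≠ 0 := by
  obtain ⟨η, hη⟩ := exists_prod_ne_zero hv
  refine Function.ne_iff.2 ⟨(p, η), ?_⟩
  simp only [sections, h1, h2, and_self, if_true]
  exact mul_ne_zero (sub_ne_zero.2 hp) (hη _)

/-- In the universal space the blow-up coordinates are proportional to the sections, since this
is a closed condition. -/
lemma rep_mul_idealSections_of_mem_universalSpace
    {x : Ambient i j} (hx : x ∈ universalSpace i j) (S : Cluster i j)
    (q q' : ChartPair i j × (ChartPair i j → Fin 2)) :
    (x.2 S).rep q * idealSections S.1 x.1 q' = (x.2 S).rep q' * idealSections S.1 x.1 q := by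
  choose e he using fun p => exists_rep_ne_zero (x.1 p)
  obtain ⟨f, hf⟩ := exists_rep_ne_zero (x.2 S)
  -- continuous local choices of homogeneous coordinates
  let r : Ambient i j → ChartPair i j → ℂ := fun y p => ((y.1 p).rep (e p))⁻¹
  let N : Ambient i j → ChartPair i j → Fin 2 → ℂ := fun y p => r y p • (y.1 p).rep
  let M : Ambient i j → ChartPair i j × (ChartPair i j → Fin 2) → ℂ :=
    fun y q => (y.2 S).rep q / (y.2 S).rep f
  let U : Set (Ambient i j) := {y | (∀ p, (y.1 p).rep (e p) ≠ 0) ∧ (y.2 S).rep f ≠ 0}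
  have hU : U ∈ nhds x := by
    refine IsOpen.mem_nhds ?_ ⟨he, hf⟩
    have h1 : IsOpen {y : Ambient i j | ∀ p, (y.1 p).rep (e p) ≠ 0} := by
      rw [Set.ofPred_forall]
      exact isOpen_iInter_of_finite fun p =>
        (isOpen_rep_ne_zero (e p)).preimage
          (f := fun y : Ambient i j => y.1 p) ((continuous_apply p).comp continuous_fst)
    exact h1.inter ((isOpen_rep_ne_zero f).preimage
      (f := fun y : Ambient i j => y.2 S) ((continuous_apply S).comp continuous_snd))
  have hN : ContinuousAt N x := by
    refine continuousAt_pi.2 fun p => continuousAt_pi.2 fun a => ?_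
    have h1 := (continuousOn_rep_div (e p) a).continuousAt
      ((isOpen_rep_ne_zero (e p)).mem_nhds (he p))
    have h2 : ContinuousAt (fun y : Ambient i j => y.1 p) x :=
      ((continuous_apply p).comp continuous_fst).continuousAt
    have h3 := ContinuousAt.comp (f := fun y : Ambient i j => y.1 p) (x := x) h1 h2
    refine h3.congr (Filter.Eventually.of_forall fun y => ?_)
    simp only [Function.comp, N, r, Pi.smul_apply, smul_eq_mul, div_eq_inv_mul]
  have hM : ∀ q, ContinuousAt (fun y => M y q) x := by
    intro q
    have h1 := (continuousOn_rep_div f q).continuousAt ((isOpen_rep_ne_zero f).mem_nhds hf)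
    have h2 : ContinuousAt (fun y : Ambient i j => y.2 S) x :=
      ((continuous_apply S).comp continuous_snd).continuousAt
    exact ContinuousAt.comp (f := fun y : Ambient i j => y.2 S) (x := x) h1 h2
  have hs : ∀ q, ContinuousAt (fun y => sections S.1 (N y) q) x := by
    intro q
    have hsc : Continuous fun v : ChartPair i j → Fin 2 → ℂ => sections S.1 v q := by
      unfold sections
      split_ifs
      · fun_prop
      · exact continuous_const
    exact ContinuousAt.comp (f := N) hsc.continuousAt hN
  have hrel : ∀ y : Ambient i j, ∃ c : ℂ, sections S.1 (N y) = c • idealSections S.1 y.1 ∧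
      ((∀ p, (y.1 p).rep (e p) ≠ 0) → c ≠ 0) := by
    intro y
    refine ⟨_, sections_smul S.1 (fun p => (y.1 p).rep) (r y), fun h => ?_⟩
    exact Finset.prod_ne_zero_iff.2 fun p _ => inv_ne_zero (h p)
  have key := eq_of_mem_closure hx hU ((hM q).mul (hs q')) ((hM q').mul (hs q)) (by
    rintro y ⟨⟨-, hy⟩, -⟩
    obtain ⟨c, hc, -⟩ := hrel y
    have h1 : (y.2 S).rep ∈ (y.2 S).submodule := by
      rw [Projectivization.submodule_eq]; exact Submodule.mem_span_singleton_self _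
    rw [hy S] at h1
    obtain ⟨b, hb⟩ := Submodule.mem_span_singleton.1 h1
    simp only [M, Pi.mul_apply, hc, ← hb, Pi.smul_apply, smul_eq_mul]
    ring_nf)
  obtain ⟨c, hc, hc0⟩ := hrel x
  simp only [M, Pi.mul_apply, hc, Pi.smul_apply, smul_eq_mul] at key
  have hc0 := hc0 he
  field_simp at key
  linear_combination key

/-! ### Limits of curves in the main stratum -/

/-- Homogeneous coordinates of the points `(x_k : x_l)` for `x_k = ε ^ d_k * u_k`, with common
powers of `ε` cancelled, so that `ε = 0` is allowed (the subtraction of levels is truncated). -/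
def levelLine (d : Fin n → ℕ) (u : Fin n → ℂ) (ε : ℂ) (p : ChartPair i j) : Fin 2 → ℂ :=
  ![ε ^ (d p.1.1 - d p.1.2) * u p.1.1, ε ^ (d p.1.2 - d p.1.1) * u p.1.2]

/-- The leading terms `ε ^ d_k * u_k` agree for all `k ∈ S`. -/
def IsCollision (d : Fin n → ℕ) (u : Fin n → ℂ) (S : Finset (Fin n)) : Prop :=
  ∀ k ∈ S, ∀ l ∈ S, d k = d l ∧ u k = u l

open Classical in
/-- Homogeneous coordinates in the fibre of the blow-up along `F̄_S`: the sections at the point with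
coordinates `v`, unless the leading terms of the curve collide on `S` (this is the condition `C`),
when the differences `v_k - v_l` are replaced by those of the second order terms `a`. -/
def blowUpVector (C : Prop) (S : Finset (Fin n)) (v : ChartPair i j → Fin 2 → ℂ) (a : Fin n → ℂ) :
    ChartPair i j × (ChartPair i j → Fin 2) → ℂ :=
  if C then fun q =>
    if q.1.1.1 ∈ S ∧ q.1.1.2 ∈ S then
      (a q.1.1.1 - a q.1.1.2) *
        ∏ b : ChartPair i j with b ≠ q.1 ∧ b.1.1 ∈ S ∧ b.1.2 ∈ S, v b (q.2 b)
    else 0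
  else sections S v

lemma continuous_blowUpVector (C : Prop) (S : Finset (Fin n)) :
    Continuous fun y : (ChartPair i j → Fin 2 → ℂ) × (Fin n → ℂ) => blowUpVector C S y.1 y.2 := by
  refine continuous_pi fun q => ?_
  by_cases hC : C <;> by_cases hq : q.1.1.1 ∈ S ∧ q.1.1.2 ∈ S <;>
    simp only [blowUpVector, sections, hC, hq, and_self, if_true, if_false]
  all_goals fun_prop

lemma continuous_levelLine (d : Fin n → ℕ) :
    Continuous fun y : (Fin n → ℂ) × ℂ => (levelLine d y.1 y.2 : ChartPair i j → Fin 2 → ℂ) := by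
  refine continuous_pi fun p => continuous_pi fun a => ?_
  unfold levelLine
  fin_cases a <;> simp <;> fun_prop

lemma levelLine_zero_ne_zero {d : Fin n → ℕ} {u : Fin n → ℂ} (hu : ∀ k, u k ≠ 0)
    (p : ChartPair i j) : levelLine d u 0 p ≠ 0 := by
  rcases le_total (d p.1.1) (d p.1.2) with h | h
  · refine Function.ne_iff.2 ⟨0, ?_⟩
    simp [levelLine, Nat.sub_eq_zero_of_le h, hu]
  · refine Function.ne_iff.2 ⟨1, ?_⟩
    simp [levelLine, Nat.sub_eq_zero_of_le h, hu]

/-- The leading terms are non-zero, and where two of them collide the second order terms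
differ. -/
def IsAdmissible (i j : Fin n) (d : Fin n → ℕ) (u a : Fin n → ℂ) : Prop :=
  (∀ k, u k ≠ 0) ∧ ∀ k l, k ≠ i → k ≠ j → l ≠ i → l ≠ j → k ≠ l → d k = d l → u k = u l → a k ≠ a l

lemma levelLine_zero_apply_ne {d : Fin n → ℕ} {u : Fin n → ℂ} (hu : ∀ k, u k ≠ 0)
    {p : ChartPair i j} (h : ¬ (d p.1.1 = d p.1.2 ∧ u p.1.1 = u p.1.2)) :
    levelLine d u 0 p 0 ≠ levelLine d u 0 p 1 := by
  rcases lt_trichotomy (d p.1.1) (d p.1.2) with hd | hd | hd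
  · have h1 : d p.1.2 - d p.1.1 ≠ 0 := by omega
    simp [levelLine, Nat.sub_eq_zero_of_le hd.le, h1, hu]
  · have h1 : u p.1.1 ≠ u p.1.2 := fun h2 => h ⟨hd, h2⟩
    simpa [levelLine, hd] using h1
  · have h1 : d p.1.1 - d p.1.2 ≠ 0 := by omega
    simpa [levelLine, Nat.sub_eq_zero_of_le hd.le, h1] using (hu _).symm

lemma blowUpVector_zero_ne_zero {d : Fin n → ℕ} {u a : Fin n → ℂ} (h : IsAdmissible i j d u a)
    (S : Cluster i j) :
    blowUpVector (IsCollision d u S.1) S.1 (levelLine d u 0 : ChartPair i j → Fin 2 → ℂ) a ≠ 0 := by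
  by_cases hC : IsCollision d u S.1
  · obtain ⟨k, hk, l, hl, hkl⟩ := Finset.one_lt_card.1 (lt_of_lt_of_le (by norm_num) S.2.2.2)
    obtain ⟨p, hp1, hp2⟩ : ∃ p : ChartPair i j, p.1.1 ∈ S.1 ∧ p.1.2 ∈ S.1 := by
      rcases exists_chartPair (S.ne_of_mem hk) (S.ne_of_mem hl) hkl with ⟨p, hp⟩ | ⟨p, hp⟩ <;>
        exact ⟨p, by simpa [hp], by simpa [hp]⟩
    obtain ⟨η, hη⟩ := exists_prod_ne_zero (levelLine_zero_ne_zero (i := i) (j := j) (d := d) h.1)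
    refine Function.ne_iff.2 ⟨(p, η), ?_⟩
    simp only [blowUpVector, hC, hp1, hp2, and_self, if_true]
    obtain ⟨hd, hu⟩ := hC _ hp1 _ hp2
    refine mul_ne_zero (sub_ne_zero.2 ?_) (hη _)
    exact h.2 _ _ p.2.2.1 p.2.2.2.1 p.2.2.2.2.1 p.2.2.2.2.2 p.2.1.ne hd hu
  · simp only [blowUpVector, hC, if_false]
    simp only [IsCollision] at hC
    push Not at hC
    obtain ⟨k, hk, l, hl, hkl⟩ := hC
    have hne : k ≠ l := by rintro rfl; exact hkl rfl rfl
    rcases exists_chartPair (S.ne_of_mem hk) (S.ne_of_mem hl) hne with ⟨p, hp⟩ | ⟨p, hp⟩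
    · refine sections_ne_zero (p := p) (levelLine_zero_ne_zero h.1) (by simpa [hp]) (by simpa [hp])
        (levelLine_zero_apply_ne h.1 ?_)
      rw [hp]; exact fun h => hkl h.1 h.2
    · refine sections_ne_zero (p := p) (levelLine_zero_ne_zero h.1) (by simpa [hp]) (by simpa [hp])
        (levelLine_zero_apply_ne h.1 ?_)
      rw [hp]; exact fun h => hkl h.1.symm h.2.symm

/-- The limit for `ε → 0` of the points of the main stratum with `x_k = ε ^ d_k (u_k + ε a_k)`. -/
def limitPoint {d : Fin n → ℕ} {u a : Fin n → ℂ} (h : IsAdmissible i j d u a) :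
    Ambient i j :=
  (fun p => Projectivization.mk ℂ (levelLine d u 0 p) (levelLine_zero_ne_zero h.1 p),
    fun S => Projectivization.mk ℂ _ (blowUpVector_zero_ne_zero h S))

lemma mk_levelLine_mem_mainParameters (hij : i < j) {d : Fin n → ℕ} {u : Fin n → ℂ} {ε : ℂ}
    (hε : ε ≠ 0) (hu : ∀ k, u k ≠ 0) (h0 : ∀ p : ChartPair i j, levelLine d u ε p ≠ 0)
    (hne : ∀ p : ChartPair i j, levelLine d u ε p 0 ≠ levelLine d u ε p 1) :
    (fun p => Projectivization.mk ℂ (levelLine d u ε p) (h0 p)) ∈ mainParameters i j := by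
  let z : Fin n → ℂ := fun k => ε ^ d k * u k
  have hz : ∀ k, z k ≠ 0 := fun k => mul_ne_zero (pow_ne_zero _ hε) (hu k)
  have hpow : ∀ r s : ℕ, ε ^ (r - s) * ε ^ s = ε ^ (s - r) * ε ^ r := by
    intro r s
    rw [← pow_add, ← pow_add]; congr 1; omega
  refine ⟨chartPoint hij.ne z 1, ?_, z, 1, rfl, fun p => ?_⟩
  · intro k l hkl
    obtain ⟨c, hc, hp⟩ := exists_plucker_eq (L := chartPoint hij.ne z 1)
      (A := chartMatrix i j z 1) rfl
    simp only [Set.mem_univ, true_iff, hp]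
    refine mul_ne_zero hc ?_
    by_cases hki : k = i
    · subst hki
      by_cases hlj : l = j
      · subst hlj; simp [minor, chartMatrix, hij.ne']
      · simp [minor, chartMatrix, hkl.ne', hlj]
    by_cases hkj : k = j
    · subst hkj
      have hli : l ≠ i := (hij.trans hkl).ne'
      simp [minor, chartMatrix, hij.ne', hkl.ne', hli, hz]
    by_cases hli : l = i
    · subst hli; simp [minor, chartMatrix, hki, hkj]
    by_cases hlj : l = j
    · subst hlj; simp [minor, chartMatrix, hki, hkj, hij.ne', hz]
    have h1 := hne ⟨(k, l), hkl, hki, hkj, hli, hlj⟩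
    have h2 : minor (chartMatrix i j z 1) k l = z k - z l := by
      simp [minor, chartMatrix, hki, hkj, hli, hlj]
    rw [h2, sub_ne_zero]
    intro h3
    refine h1 ?_
    simp only [levelLine, Matrix.cons_val_zero, Matrix.cons_val_one]
    simp only [z] at h3
    have hk := hpow (d k) (d l)
    refine mul_right_cancel₀ (pow_ne_zero (d l) hε) ?_
    refine mul_right_cancel₀ (pow_ne_zero (d k) hε) ?_
    linear_combination u k * ε ^ d k * hk + ε ^ (d l - d k) * ε ^ d k * h3
  · obtain ⟨c, hc, hr⟩ := exists_rep_mk_eq (levelLine d u ε p) (h0 p)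
    rw [hr, hr]
    simp only [levelLine, Matrix.cons_val_zero, Matrix.cons_val_one, z, Pi.one_apply]
    linear_combination -(c * u p.1.1 * u p.1.2) * hpow (d p.1.1) (d p.1.2)

lemma blowUpVector_smul_of_collision {d : Fin n → ℕ} {u a : Fin n → ℂ} {S : Finset (Fin n)} (ε : ℂ)
    (hC : IsCollision d u S) :
    sections S (levelLine d (u + ε • a) ε : ChartPair i j → Fin 2 → ℂ) =
      ε • blowUpVector (IsCollision d u S) S (levelLine d (u + ε • a) ε) a := by
  funext q
  simp only [blowUpVector, hC, if_true, sections, Pi.smul_apply, smul_eq_mul]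
  split_ifs with hq
  · obtain ⟨hd, hu⟩ := hC _ hq.1 _ hq.2
    have : (levelLine d (u + ε • a) ε : ChartPair i j → Fin 2 → ℂ) q.1 0 -
        (levelLine d (u + ε • a) ε : ChartPair i j → Fin 2 → ℂ) q.1 1 =
        ε * (a q.1.1.1 - a q.1.1.2) := by
      simp [levelLine, hd, hu]; ring
    rw [this]; ring
  · simp

/-- The universal space contains the limits of curves in the main stratum. -/
theorem limitPoint_mem_universalSpace (hij : i < j) {d : Fin n → ℕ} {u a : Fin n → ℂ}
    (h : IsAdmissible i j d u a) : limitPoint h ∈ universalSpace i j := by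
  let v : ℂ → ChartPair i j → Fin 2 → ℂ := fun ε => levelLine d (u + ε • a) ε
  let b : Cluster i j → ℂ → ChartPair i j × (ChartPair i j → Fin 2) → ℂ :=
    fun S ε => blowUpVector (IsCollision d u S.1) S.1 (v ε) a
  have hv : Continuous v := (continuous_levelLine d).comp (by fun_prop :
    Continuous fun ε : ℂ => (u + ε • a, ε))
  have hb : ∀ S, Continuous (b S) := fun S =>
    (continuous_blowUpVector (IsCollision d u S.1) S.1).comp (hv.prodMk continuous_const)
  have hv0 : v 0 = levelLine d u 0 := by simp [v]
  have hb0 : ∀ S, b S 0 = blowUpVector (IsCollision d u S.1) S.1 (levelLine d u 0) a :=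
    fun S => by simp only [b, hv0]
  let U := {ε : ℂ // (∀ p, v ε p ≠ 0) ∧ ∀ S, b S ε ≠ 0}
  let ε₀ : U := ⟨0, fun p => by rw [hv0]; exact levelLine_zero_ne_zero h.1 p,
    fun S => by rw [hb0]; exact blowUpVector_zero_ne_zero h S⟩
  let y : U → Ambient i j := fun ε =>
    (fun p => Projectivization.mk ℂ (v ε.1 p) (ε.2.1 p),
      fun S => Projectivization.mk ℂ (b S ε.1) (ε.2.2 S))
  have hy : Continuous y := by
    refine Continuous.prodMk (continuous_pi fun p => ?_) (continuous_pi fun S => ?_)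
    · exact continuous_projMk (((continuous_apply p).comp hv).comp continuous_subtype_val) _
    · exact continuous_projMk ((hb S).comp continuous_subtype_val) _
  have hy0 : y ε₀ = limitPoint h := by
    simp only [y, limitPoint, ε₀, hv0, hb0]
  rw [← hy0]
  let G : Set U := {ε | ε.1 ≠ 0 ∧ (∀ k, u k + ε.1 * a k ≠ 0) ∧ ∀ p, v ε.1 p 0 ≠ v ε.1 p 1}
  refine map_mem_closure hy (s := G) ?_ ?_
  · rw [closure_subtype]
    have h1 : ∀ᶠ ε in nhds (0 : ℂ), (∀ p, v ε p ≠ 0) ∧ ∀ S, b S ε ≠ 0 := by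
      refine Filter.Eventually.and (Filter.eventually_all.2 fun p => ?_)
        (Filter.eventually_all.2 fun S => ?_)
      · exact ((continuous_apply p).comp hv).continuousAt.eventually_ne (ε₀.2.1 p)
      · exact (hb S).continuousAt.eventually_ne (ε₀.2.2 S)
    have h2 : ∀ᶠ ε in nhds (0 : ℂ), ∀ k, u k + ε * a k ≠ 0 := by
      refine Filter.eventually_all.2 fun k => ?_
      have : Continuous fun ε : ℂ => u k + ε * a k := by fun_prop
      exact this.continuousAt.eventually_ne (by simpa using h.1 k)
    have h3 : ∀ᶠ ε in nhdsWithin (0 : ℂ) {0}ᶜ, ∀ p, v ε p 0 ≠ v ε p 1 := by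
      refine Filter.eventually_all.2 fun p => ?_
      by_cases hC : d p.1.1 = d p.1.2 ∧ u p.1.1 = u p.1.2
      · filter_upwards [self_mem_nhdsWithin] with ε hε
        have ha := h.2 _ _ p.2.2.1 p.2.2.2.1 p.2.2.2.2.1 p.2.2.2.2.2 p.2.1.ne hC.1 hC.2
        simp only [v, levelLine, hC.1, hC.2, Nat.sub_self, pow_zero, one_mul, Pi.add_apply,
          Pi.smul_apply, smul_eq_mul, Matrix.cons_val_zero, Matrix.cons_val_one]
        intro h4
        exact ha (mul_left_cancel₀ hε (add_left_cancel h4))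
      · refine Filter.Eventually.filter_mono nhdsWithin_le_nhds ?_
        have hvp : ∀ e : Fin 2, Continuous fun ε => v ε p e := fun e =>
          (continuous_apply e).comp ((continuous_apply p).comp hv)
        refine ((hvp 0).continuousAt.ne_iff_eventually_ne (hvp 1).continuousAt).1 ?_
        rw [hv0]; exact levelLine_zero_apply_ne h.1 hC
    have h4 : ∀ᶠ ε in nhdsWithin (0 : ℂ) {0}ᶜ, ε ∈ Subtype.val '' G := by
      filter_upwards [h3, Filter.Eventually.filter_mono nhdsWithin_le_nhds h1,
        Filter.Eventually.filter_mono nhdsWithin_le_nhds h2, self_mem_nhdsWithin]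
        with ε e3 e1 e2 e0
      exact ⟨⟨ε, e1⟩, ⟨e0, e2, e3⟩, rfl⟩
    exact mem_closure_of_frequently_of_tendsto h4.frequently
      (Filter.tendsto_id.mono_left nhdsWithin_le_nhds)
  · rintro ⟨ε, hε⟩ ⟨e0, e1, e2⟩
    refine ⟨mk_levelLine_mem_mainParameters hij e0 (fun k => by simpa using e1 k) hε.1 e2,
      fun S => ?_⟩
    obtain ⟨c, hc, hs⟩ := span_idealSections_mk S.1 (v ε) hε.1
    have h1 : Submodule.span ℂ {idealSections S.1 (y ⟨ε, hε⟩).1} =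
        Submodule.span ℂ {sections S.1 (v ε)} := by
      rw [show idealSections S.1 (y ⟨ε, hε⟩).1 = c • sections S.1 (v ε) from hs]
      exact Submodule.span_singleton_smul_eq (isUnit_iff_ne_zero.2 hc) _
    have h2 : Submodule.span ℂ {sections S.1 (v ε)} = Submodule.span ℂ {b S ε} := by
      by_cases hC : IsCollision d u S.1
      · rw [show sections S.1 (v ε) = ε • b S ε from blowUpVector_smul_of_collision ε hC]
        exact Submodule.span_singleton_smul_eq (isUnit_iff_ne_zero.2 e0) _
      · simp only [b, blowUpVector, hC, if_false]
    rw [h1, h2]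
    exact Projectivization.submodule_mk _ _

/-- The limit points depend continuously on the coefficients of the curves, as long as the
collisions remain the same. -/
lemma continuous_limitPoint {Y : Type*} [TopologicalSpace Y] {d : Fin n → ℕ} {u a : Y → Fin n → ℂ}
    (hu : Continuous u) (ha : Continuous a) (h : ∀ y, IsAdmissible i j d (u y) (a y))
    (C : Finset (Fin n) → Prop) (hC : ∀ y (S : Cluster i j), IsCollision d (u y) S.1 ↔ C S.1) :
    Continuous fun y => limitPoint (h y) := by
  have hl : Continuous fun y => (levelLine d (u y) 0 : ChartPair i j → Fin 2 → ℂ) :=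
    (continuous_levelLine d).comp (hu.prodMk continuous_const)
  refine Continuous.prodMk (continuous_pi fun p => ?_) (continuous_pi fun S => ?_)
  · exact continuous_projMk ((continuous_apply p).comp hl) _
  · refine continuous_projMk ?_ _
    simp only [hC]
    exact (continuous_blowUpVector (C S.1) S.1).comp (hl.prodMk ha)

end Sections

/-! ### Strata in a chart -/

section Strata

variable {n : ℕ} {i j : Fin n} {L L' L'' : Gr n}

lemma plucker_self (L : Gr n) (k : Fin n) : plucker L k k = 0 := by
  simp only [plucker, minor]; ring

lemma mem_stratum_support_iff :
    L' ∈ stratum (support L) ↔ ∀ k l, plucker L' k l = 0 ↔ plucker L k l = 0 := by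
  constructor
  · intro h k l
    rcases lt_trichotomy k l with hkl | hkl | hkl
    · have := h k l hkl
      simp only [support, Set.mem_ofPred_eq, hkl, true_and] at this
      exact (not_iff_not.1 this).symm
    · subst hkl; simp [plucker_self]
    · have := h l k hkl
      simp only [support, Set.mem_ofPred_eq, hkl, true_and] at this
      rw [plucker_swap L', plucker_swap L, neg_eq_zero, neg_eq_zero]
      exact (not_iff_not.1 this).symm
  · intro h k l hkl
    simp only [support, Set.mem_ofPred_eq, hkl, true_and, ne_eq, h k l]

lemma plucker_eq_zero_iff_coord (hL : plucker L i j ≠ 0) (k l : Fin n) :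
    plucker L k l = 0 ↔ zCoord i j L k * wCoord i j L l = wCoord i j L k * zCoord i j L l := by
  rw [plucker_eq_coord hL, mul_eq_zero, sub_eq_zero]
  simp [hL]

lemma zCoord_left (hL : plucker L i j ≠ 0) : zCoord i j L i = 1 := div_self hL

lemma wCoord_left : wCoord i j L i = 0 := by simp [wCoord, plucker_self]

lemma zCoord_right : zCoord i j L j = 0 := by simp [zCoord, plucker_self]

lemma wCoord_right (hL : plucker L i j ≠ 0) : wCoord i j L j = 1 := div_self hL

/-- Row `k` of the chart matrix of `L` has no zero entry. -/
def IsGeneric (i j : Fin n) (L : Gr n) (k : Fin n) : Prop :=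
  zCoord i j L k ≠ 0 ∧ wCoord i j L k ≠ 0

lemma IsGeneric.ne {k : Fin n} (h : IsGeneric i j L k) : k ≠ i ∧ k ≠ j :=
  ⟨fun e => h.2 (e ▸ wCoord_left), fun e => h.1 (e ▸ zCoord_right)⟩

/-- The slope `x_k = z_k / w_k` of row `k` of the chart matrix of `L`. -/
def slope (i j : Fin n) (L : Gr n) (k : Fin n) : ℂ := zCoord i j L k / wCoord i j L k

lemma IsGeneric.slope_ne_zero {k : Fin n} (h : IsGeneric i j L k) : slope i j L k ≠ 0 :=
  div_ne_zero h.1 h.2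

lemma plucker_eq_zero_iff_slope (hL : plucker L i j ≠ 0) {k l : Fin n} (hk : IsGeneric i j L k)
    (hl : IsGeneric i j L l) : plucker L k l = 0 ↔ slope i j L k = slope i j L l := by
  rw [plucker_eq_zero_iff_coord hL, slope, slope, div_eq_div_iff hk.2 hl.2,
    mul_comm (wCoord i j L k)]

lemma plucker_base_ne_zero (hL : plucker L i j ≠ 0) (h : L' ∈ stratum (support L)) :
    plucker L' i j ≠ 0 := fun h0 => hL ((mem_stratum_support_iff.1 h i j).1 h0)

lemma zCoord_eq_zero_iff (hL : plucker L i j ≠ 0) (h : L' ∈ stratum (support L)) (k : Fin n) :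
    zCoord i j L' k = 0 ↔ zCoord i j L k = 0 := by
  simp only [zCoord, div_eq_zero_iff, plucker_base_ne_zero hL h, hL, or_false]
  exact mem_stratum_support_iff.1 h k j

lemma wCoord_eq_zero_iff (hL : plucker L i j ≠ 0) (h : L' ∈ stratum (support L)) (k : Fin n) :
    wCoord i j L' k = 0 ↔ wCoord i j L k = 0 := by
  simp only [wCoord, div_eq_zero_iff, plucker_base_ne_zero hL h, hL, or_false]
  exact mem_stratum_support_iff.1 h i k

lemma isGeneric_iff (hL : plucker L i j ≠ 0) (h : L' ∈ stratum (support L)) (k : Fin n) :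
    IsGeneric i j L' k ↔ IsGeneric i j L k := by
  simp only [IsGeneric, ne_eq, zCoord_eq_zero_iff hL h, wCoord_eq_zero_iff hL h]

/-! ### Normal forms of points of a stratum -/

open Classical in
/-- The coordinates `z` of the normal form with slopes `u`, where all non-zero `w_k` are `1`. -/
def normalZ (i j : Fin n) (L : Gr n) (u : Fin n → ℂ) (k : Fin n) : ℂ :=
  if zCoord i j L k = 0 then 0 else if wCoord i j L k = 0 then 1 else u k

open Classical in
/-- The coordinates `w` of the normal form. -/
def normalW (i j : Fin n) (L : Gr n) (k : Fin n) : ℂ := if wCoord i j L k = 0 then 0 else 1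

lemma coord_normalPoint (hij : i ≠ j) (hL : plucker L i j ≠ 0) (u : Fin n → ℂ) (k : Fin n) :
    zCoord i j (chartPoint hij (normalZ i j L u) (normalW i j L)) k = normalZ i j L u k ∧
      wCoord i j (chartPoint hij (normalZ i j L u) (normalW i j L)) k = normalW i j L k := by
  have h0 : plucker (chartPoint hij (normalZ i j L u) (normalW i j L)) i j ≠ 0 :=
    plucker_ne_zero_of_eq_colSpan hij rfl
  by_cases hki : k = i
  · subst hki
    simp [zCoord_left h0, wCoord_left, normalZ, normalW, zCoord_left hL]
  by_cases hkj : k = j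
  · subst hkj
    simp [zCoord_right, wCoord_right h0, normalZ, normalW, wCoord_right hL]
  exact coord_eq_of_eq_colSpan hij rfl hki hkj

lemma normalPoint_mem_stratum (hij : i ≠ j) (hL : plucker L i j ≠ 0) {u : Fin n → ℂ}
    (hu : ∀ k, IsGeneric i j L k → u k ≠ 0)
    (hx : ∀ k l, IsGeneric i j L k → IsGeneric i j L l →
      (u k = u l ↔ slope i j L k = slope i j L l)) :
    chartPoint hij (normalZ i j L u) (normalW i j L) ∈ stratum (support L) := by
  rw [mem_stratum_support_iff]
  intro k l
  rw [plucker_eq_zero_iff_coord (plucker_ne_zero_of_eq_colSpan hij rfl),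
    (coord_normalPoint hij hL u k).1, (coord_normalPoint hij hL u k).2,
    (coord_normalPoint hij hL u l).1, (coord_normalPoint hij hL u l).2]
  by_cases hk : IsGeneric i j L k <;> by_cases hl : IsGeneric i j L l
  · rw [plucker_eq_zero_iff_slope hL hk hl, ← hx k l hk hl]
    simp [normalZ, normalW, hk.1, hk.2, hl.1, hl.2]
  all_goals
    rw [plucker_eq_zero_iff_coord hL]
    simp only [normalZ, normalW]
    by_cases h1 : zCoord i j L k = 0 <;> by_cases h2 : wCoord i j L k = 0 <;>
      by_cases h3 : zCoord i j L l = 0 <;> by_cases h4 : wCoord i j L l = 0 <;>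
      simp_all [IsGeneric, @eq_comm ℂ 0]

/-! ### Torus orbits in a stratum -/

lemma slope_smul (t : Fin n → ℂˣ) (L : Gr n) (k : Fin n) :
    slope i j (t • L) k = (t j / t i : ℂ) * slope i j L k := by
  obtain ⟨c, hc, h⟩ := exists_plucker_smul t L
  have hi := (t i).ne_zero
  have hj := (t j).ne_zero
  have hk := (t k).ne_zero
  by_cases h1 : plucker L i j = 0
  · simp [slope, zCoord, wCoord, h, h1]
  by_cases h2 : plucker L i k = 0
  · simp [slope, zCoord, wCoord, h, h2]
  simp only [slope, zCoord, wCoord, h]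
  field_simp

/-- Two points of a stratum with proportional slopes lie in the same torus orbit. -/
lemma exists_smul_eq_of_slope (hL : plucker L i j ≠ 0) (h' : L' ∈ stratum (support L))
    (h'' : L'' ∈ stratum (support L))
    (hs : ∀ k l, IsGeneric i j L k → IsGeneric i j L l →
      slope i j L'' k * slope i j L' l = slope i j L'' l * slope i j L' k) :
    ∃ t : Fin n → ℂˣ, t • L' = L'' := by
  classical
  have hij := ne_of_plucker_ne_zero hL
  have z1 := zCoord_eq_zero_iff hL h'
  have z2 := zCoord_eq_zero_iff hL h''
  have w1 := wCoord_eq_zero_iff hL h'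
  have w2 := wCoord_eq_zero_iff hL h''
  -- the common factor of the slopes
  obtain ⟨τ, hτ0, hτ⟩ : ∃ τ : ℂ, τ ≠ 0 ∧ ∀ k, IsGeneric i j L k →
      slope i j L'' k = τ * slope i j L' k := by
    by_cases hg : ∃ k, IsGeneric i j L k
    · obtain ⟨k₀, h0⟩ := hg
      have g1 := ((isGeneric_iff hL h' k₀).2 h0).slope_ne_zero
      have g2 := ((isGeneric_iff hL h'' k₀).2 h0).slope_ne_zero
      refine ⟨slope i j L'' k₀ / slope i j L' k₀, div_ne_zero g2 g1, fun k hk => ?_⟩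
      rw [div_mul_eq_mul_div, eq_div_iff g1, hs k k₀ hk h0]
    · exact ⟨1, one_ne_zero, fun k hk => absurd ⟨k, hk⟩ hg⟩
  let s : Fin n → ℂ := fun k =>
    if k = i then 1 else if k = j then τ else
    if zCoord i j L k ≠ 0 then zCoord i j L'' k / zCoord i j L' k else
    if wCoord i j L k ≠ 0 then τ * (wCoord i j L'' k / wCoord i j L' k) else 1
  have hsne : ∀ k, s k ≠ 0 := by
    intro k
    simp only [s]
    split_ifs with a b c d
    · exact one_ne_zero
    · exact hτ0
    · exact div_ne_zero (fun h => c ((z2 k).1 h)) (fun h => c ((z1 k).1 h))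
    · exact mul_ne_zero hτ0 (div_ne_zero (fun h => d ((w2 k).1 h)) (fun h => d ((w1 k).1 h)))
    · exact one_ne_zero
  refine ⟨fun k => Units.mk0 (s k) (hsne k), ?_⟩
  rw [← chartPoint_coord hij (plucker_base_ne_zero hL h'),
    ← chartPoint_coord hij (plucker_base_ne_zero hL h'')]
  have si : s i = 1 := by simp [s]
  have sj : s j = τ := by simp [s, hij.symm]
  refine smul_chartPoint_eq hij _ (fun k hki hkj => ?_) fun k hki hkj => ?_
  · simp only [Units.val_mk0, si, mul_one]
    simp only [s, hki, hkj, if_false]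
    by_cases hz : zCoord i j L k = 0
    · rw [(z1 k).2 hz, (z2 k).2 hz, mul_zero]
    · rw [if_pos hz, div_mul_cancel₀ _ (fun h => hz ((z1 k).1 h))]
  · simp only [Units.val_mk0, sj]
    simp only [s, hki, hkj, if_false]
    by_cases hw : wCoord i j L k = 0
    · rw [(w1 k).2 hw, (w2 k).2 hw, mul_zero, zero_mul]
    · have hw1 : wCoord i j L' k ≠ 0 := fun h => hw ((w1 k).1 h)
      have hw2 : wCoord i j L'' k ≠ 0 := fun h => hw ((w2 k).1 h)
      by_cases hz : zCoord i j L k = 0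
      · simp only [hz, hw, ne_eq, not_true, if_false, not_false_iff, if_true]
        field_simp
      · have hz1 : zCoord i j L' k ≠ 0 := fun h => hz ((z1 k).1 h)
        have := hτ k ⟨hz, hw⟩
        simp only [slope] at this
        rw [if_pos hz]
        field_simp at this ⊢
        linear_combination -this

/-! ### The space of parameters of a stratum -/

/-- The point of the space of parameters represented by a point of the stratum. -/
def paramMk {σ : Set (Fin n × Fin n)} (L : {L : Gr n // L ∈ stratum σ}) : ParameterSpace σ :=
  Quotient.mk _ L

lemma continuous_paramMk {σ : Set (Fin n × Fin n)} : Continuous (paramMk (σ := σ)) :=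
  continuous_quotient_mk'

lemma paramMk_eq_iff {σ : Set (Fin n × Fin n)} {A B : {L : Gr n // L ∈ stratum σ}} :
    paramMk A = paramMk B ↔ ∃ t : Fin n → ℂˣ, t • B.1 = A.1 :=
  Quotient.eq

lemma exists_paramMk_eq {σ : Set (Fin n × Fin n)} (y : ParameterSpace σ) : ∃ A, paramMk A = y :=
  Quotient.exists_rep y

/-- A continuous function on a stratum which is constant on torus orbits is continuous on the space
of parameters. -/
lemma exists_continuous_lift {σ : Set (Fin n × Fin n)} {Y : Type*} [TopologicalSpace Y]
    {f : {L : Gr n // L ∈ stratum σ} → Y} (hf : Continuous f)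
    (h : ∀ A B, (∃ t : Fin n → ℂˣ, t • B.1 = A.1) → f A = f B) :
    ∃ F : ParameterSpace σ → Y, Continuous F ∧ ∀ A, F (paramMk A) = f A :=
  ⟨Quotient.lift f h, hf.quotient_lift h, fun _ => rfl⟩

lemma continuous_zCoord (hL : plucker L i j ≠ 0) (k : Fin n) :
    Continuous fun A : {L' : Gr n // L' ∈ stratum (support L)} => zCoord i j A.1 k :=
  (continuousOn_plucker_div k j i j).comp_continuous continuous_subtype_val
    fun A => plucker_base_ne_zero hL A.2

lemma continuous_wCoord (hL : plucker L i j ≠ 0) (k : Fin n) :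
    Continuous fun A : {L' : Gr n // L' ∈ stratum (support L)} => wCoord i j A.1 k :=
  (continuousOn_plucker_div i k i j).comp_continuous continuous_subtype_val
    fun A => plucker_base_ne_zero hL A.2

lemma continuous_slope (hL : plucker L i j ≠ 0) {k : Fin n} (hk : IsGeneric i j L k) :
    Continuous fun A : {L' : Gr n // L' ∈ stratum (support L)} => slope i j A.1 k :=
  (continuous_zCoord hL k).div (continuous_wCoord hL k)
    fun A => ((isGeneric_iff hL A.2 k).2 hk).2

/-- The slopes of the generic rows of `L` different from the slope of row `k₀`. -/
abbrev SlopeIndex (i j : Fin n) (L : Gr n) (k₀ : Fin n) : Type :=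
  {v : ℂ // v ≠ slope i j L k₀ ∧ ∃ k, IsGeneric i j L k ∧ slope i j L k = v}

instance (k₀ : Fin n) : Finite (SlopeIndex i j L k₀) :=
  Set.Finite.to_subtype ((Set.finite_range (slope i j L)).subset
    (by rintro v ⟨-, k, -, rfl⟩; exact ⟨k, rfl⟩))

/-- A generic row with the given slope. -/
def SlopeIndex.row {k₀ : Fin n} (v : SlopeIndex i j L k₀) : Fin n := v.2.2.choose

lemma SlopeIndex.isGeneric_row {k₀ : Fin n} (v : SlopeIndex i j L k₀) : IsGeneric i j L v.row :=
  v.2.2.choose_spec.1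

lemma SlopeIndex.slope_row {k₀ : Fin n} (v : SlopeIndex i j L k₀) : slope i j L v.row = v.1 :=
  v.2.2.choose_spec.2

/-- Ratios of slopes are coordinates on the space of parameters: one for each slope besides a
reference slope. -/
theorem exists_continuous_injective (hL : plucker L i j ≠ 0) {k₀ : Fin n}
    (h0 : ∀ k, IsGeneric i j L k → IsGeneric i j L k₀) :
    ∃ f : ParameterSpace (support L) → (SlopeIndex i j L k₀ → ℂ),
      Continuous f ∧ Function.Injective f := by
  obtain ⟨F, hF, hFv⟩ := exists_continuous_lift (σ := support L)
    (Y := SlopeIndex i j L k₀ → ℂ) (f := fun A v => slope i j A.1 v.row / slope i j A.1 k₀)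
    (continuous_pi fun v => (continuous_slope hL v.isGeneric_row).div
      (continuous_slope hL (h0 _ v.isGeneric_row))
      fun A => ((isGeneric_iff hL A.2 k₀).2 (h0 _ v.isGeneric_row)).slope_ne_zero) (by
    rintro A B ⟨t, ht⟩
    funext v
    rw [← ht, slope_smul, slope_smul, mul_div_mul_left]
    exact div_ne_zero (t j).ne_zero (t i).ne_zero)
  refine ⟨F, hF, fun a b hab => ?_⟩
  obtain ⟨A, rfl⟩ := exists_paramMk_eq a
  obtain ⟨B, rfl⟩ := exists_paramMk_eq b
  rw [hFv, hFv] at hab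
  rw [paramMk_eq_iff]
  have hk : ∀ k, IsGeneric i j L k →
      slope i j A.1 k * slope i j B.1 k₀ = slope i j A.1 k₀ * slope i j B.1 k := by
    intro k hk
    have hpar : ∀ {k l : Fin n}, IsGeneric i j L k → IsGeneric i j L l →
        slope i j L k = slope i j L l →
        ∀ C : {L' : Gr n // L' ∈ stratum (support L)}, slope i j C.1 k = slope i j C.1 l := by
      intro k l hk hl h C
      rw [← plucker_eq_zero_iff_slope (plucker_base_ne_zero hL C.2) ((isGeneric_iff hL C.2 k).2 hk)
        ((isGeneric_iff hL C.2 l).2 hl), mem_stratum_support_iff.1 C.2,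
        plucker_eq_zero_iff_slope hL hk hl]
      exact h
    by_cases hs : slope i j L k = slope i j L k₀
    · rw [hpar hk (h0 k hk) hs A, hpar hk (h0 k hk) hs B]
    · let v : SlopeIndex i j L k₀ := ⟨slope i j L k, hs, k, hk, rfl⟩
      have hv := congrFun hab v
      rw [hpar hk v.isGeneric_row v.slope_row.symm A, hpar hk v.isGeneric_row v.slope_row.symm B]
      rw [div_eq_div_iff ((isGeneric_iff hL A.2 k₀).2 (h0 k hk)).slope_ne_zero
        ((isGeneric_iff hL B.2 k₀).2 (h0 k hk)).slope_ne_zero] at hv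
      rw [hv, mul_comm]
  refine exists_smul_eq_of_slope hL B.2 A.2 fun k l gk gl => ?_
  have ek := hk k gk
  have el := hk l gl
  have nb := ((isGeneric_iff hL B.2 k₀).2 (h0 k gk)).slope_ne_zero
  refine mul_right_cancel₀ nb ?_
  linear_combination slope i j B.1 l * ek - slope i j B.1 k * el

end Strata

/-! ### Virtual spaces of parameters of excess dimension -/

section Excess

variable {n : ℕ} {i j : Fin n} {L : Gr n}

lemma limitPoint_mem_virtualSpace (hij : i < j) (hL : plucker L i j ≠ 0) {d : Fin n → ℕ}
    {u a : Fin n → ℂ} (h : IsAdmissible i j d u a)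
    (hx : ∀ k l, IsGeneric i j L k → IsGeneric i j L l →
      (u k = u l ↔ slope i j L k = slope i j L l))
    (hd : ∀ k l, IsGeneric i j L k → IsGeneric i j L l → d k = d l)
    (hlt : ∀ k l, zCoord i j L k ≠ 0 → wCoord i j L l ≠ 0 →
      ¬ (IsGeneric i j L k ∧ IsGeneric i j L l) → d k < d l) :
    limitPoint h ∈ virtualSpace i j (support L) := by
  refine ⟨limitPoint_mem_universalSpace hij h,
    chartPoint hij.ne (normalZ i j L u) (normalW i j L),
    normalPoint_mem_stratum hij.ne hL (fun k _ => h.1 k) hx, _, _, rfl, fun p => ?_⟩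
  obtain ⟨c, -, hr⟩ := exists_rep_mk_eq (levelLine d u 0 p) (levelLine_zero_ne_zero h.1 p)
  rw [show (limitPoint h).1 p = Projectivization.mk ℂ (levelLine d u 0 p) _ from rfl, hr, hr]
  obtain ⟨⟨k, l⟩, hkl⟩ := p
  simp only [levelLine, Matrix.cons_val_zero, Matrix.cons_val_one]
  by_cases hg : IsGeneric i j L k ∧ IsGeneric i j L l
  · simp only [normalZ, normalW, hg.1.1, hg.1.2, hg.2.1, hg.2.2, if_false, hd k l hg.1 hg.2,
      Nat.sub_self, pow_zero]
    ring
  · -- only the smaller level survives at `ε = 0`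
    have key : ∀ k l, ¬ (IsGeneric i j L k ∧ IsGeneric i j L l) →
        (0 : ℂ) ^ (d l - d k) * (normalZ i j L u k * normalW i j L l) = 0 := by
      intro k l hg
      by_cases hz : zCoord i j L k = 0
      · simp [normalZ, hz]
      by_cases hw : wCoord i j L l = 0
      · simp [normalW, hw]
      have := hlt k l hz hw hg
      rw [zero_pow (by omega), zero_mul]
    have e1 := key k l hg
    have e2 := key l k fun e => hg e.symm
    linear_combination (c * u l) * e1 - (c * u k) * e2

lemma mul_eq_mul_of_limitPoint_eq {d : Fin n → ℕ} {u a u' a' : Fin n → ℂ}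
    {h : IsAdmissible i j d u a} {h' : IsAdmissible i j d u' a'} (he : limitPoint h = limitPoint h')
    {k l : Fin n} (hk : k ≠ i ∧ k ≠ j) (hl : l ≠ i ∧ l ≠ j) (hkl : k ≠ l) (hd : d k = d l) :
    u k * u' l = u l * u' k := by
  have key : ∀ p : ChartPair i j, d p.1.1 = d p.1.2 → u p.1.1 * u' p.1.2 = u p.1.2 * u' p.1.1 := by
    intro p hp
    have h1 := congrFun (congrArg Prod.fst he) p
    obtain ⟨c, hc⟩ := (Projectivization.mk_eq_mk_iff' ℂ _ _ _ _).1 h1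
    have c0 := congrFun hc 0
    have c1 := congrFun hc 1
    simp only [levelLine, hp, Pi.smul_apply, smul_eq_mul, Matrix.cons_val_zero,
      Matrix.cons_val_one, Nat.sub_self, pow_zero, one_mul] at c0 c1
    rw [← c0, ← c1]; ring
  rcases exists_chartPair hk hl hkl with ⟨p, hp⟩ | ⟨p, hp⟩
  · have := key p (by rw [hp]; exact hd)
    rw [hp] at this; exact this
  · have := key p (by rw [hp]; exact hd.symm)
    rw [hp] at this; exact this.symm

/-- The blow-up coordinates determine the second order terms of colliding curves, up to affine
transformations. -/
lemma exists_sub_eq_of_limitPoint_eq {d : Fin n → ℕ} {u a a' : Fin n → ℂ}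
    {h : IsAdmissible i j d u a} {h' : IsAdmissible i j d u a'} (he : limitPoint h = limitPoint h')
    (S : Cluster i j) (hC : IsCollision d u S.1) :
    ∃ c : ℂ, ∀ k ∈ S.1, ∀ l ∈ S.1, k ≠ l → a k - a l = c * (a' k - a' l) := by
  have h1 := congrFun (congrArg Prod.snd he) S
  obtain ⟨c, hc⟩ := (Projectivization.mk_eq_mk_iff' ℂ _ _ _ _).1 h1
  obtain ⟨η, hη⟩ := exists_prod_ne_zero (levelLine_zero_ne_zero (i := i) (j := j) (d := d) h.1)
  have key : ∀ p : ChartPair i j, p.1.1 ∈ S.1 → p.1.2 ∈ S.1 →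
      a p.1.1 - a p.1.2 = c * (a' p.1.1 - a' p.1.2) := by
    intro p hp1 hp2
    have h2 := congrFun hc (p, η)
    simp only [blowUpVector, hC, hp1, hp2, and_self, if_true, Pi.smul_apply, smul_eq_mul] at h2
    refine mul_right_cancel₀ (hη _) (h2.symm.trans ?_)
    ring
  refine ⟨c, fun k hk l hl hkl => ?_⟩
  rcases exists_chartPair (S.ne_of_mem hk) (S.ne_of_mem hl) hkl with ⟨p, hp⟩ | ⟨p, hp⟩
  · have := key p (by rwa [hp]) (by rwa [hp])
    rw [hp] at this; exact this
  · have := key p (by rwa [hp]) (by rwa [hp])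
    rw [hp] at this
    linear_combination -this

/-- A virtual space of parameters which contains a continuous injective image of an open set of
dimension greater than that of the space of parameters is not homeomorphic to it. -/
lemma isEmpty_homeomorph_of_injective (hL : plucker L i j ≠ 0) {k₀ : Fin n}
    (h0 : ∀ k, IsGeneric i j L k → IsGeneric i j L k₀)
    {D : Set ((SlopeIndex i j L k₀ → ℂ) × ℝ)} (hD : IsOpen D) (hne : D.Nonempty)
    {Ψ : D → virtualSpace i j (support L)} (hΨ : Continuous Ψ) (hinj : Function.Injective Ψ) :
    IsEmpty (ParameterSpace (support L) ≃ₜ virtualSpace i j (support L)) := by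
  refine ⟨fun φ => ?_⟩
  have : Fintype (SlopeIndex i j L k₀) := Fintype.ofFinite _
  obtain ⟨f, hf, hfinj⟩ := exists_continuous_injective hL h0
  let g : D → (SlopeIndex i j L k₀ → ℂ) := fun y => f (φ.symm (Ψ y))
  have hg : Continuous g := hf.comp (φ.symm.continuous.comp hΨ)
  have hginj : Function.Injective g := hfinj.comp (φ.symm.injective.comp hinj)
  classical
  let G : (SlopeIndex i j L k₀ → ℂ) × ℝ → (SlopeIndex i j L k₀ → ℂ) :=
    fun y => if h : y ∈ D then g ⟨y, h⟩ else 0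
  have hG : ∀ y : D, G y = g y := fun y => by simp [G]
  refine not_injOn_of_finrank_lt (f := G) ?_ hD hne ?_ ?_
  · rw [Module.finrank_prod, Module.finrank_self]; exact Nat.lt_succ_self _
  · rw [continuousOn_iff_continuous_domRestrict]
    exact hg.congr fun y => (hG y).symm
  · intro x hx y hy hxy
    have h1 := (hG ⟨x, hx⟩).symm.trans (hxy.trans (hG ⟨y, hy⟩))
    exact congrArg Subtype.val (hginj h1)

/-! ### Curves tending to a stratum -/

open Classical in
/-- Slopes of normal forms: `t` prescribes the slopes of the generic rows; the rows of the same slope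
as row `k₀` have slope `1`. The value `1` at the other rows only serves to be non-zero. -/
def slopeFamily (i j : Fin n) (L : Gr n) (k₀ : Fin n) (t : SlopeIndex i j L k₀ → ℂ)
    (k : Fin n) : ℂ :=
  if h : IsGeneric i j L k ∧ slope i j L k ≠ slope i j L k₀ then
    t ⟨slope i j L k, h.2, k, h.1, rfl⟩ else 1

lemma continuous_slopeFamily (k₀ : Fin n) : Continuous (slopeFamily i j L k₀) := by
  refine continuous_pi fun k => ?_
  unfold slopeFamily
  split_ifs with h
  · exact continuous_apply _
  · exact continuous_const

lemma slopeFamily_row {k₀ : Fin n} (t : SlopeIndex i j L k₀ → ℂ) (v : SlopeIndex i j L k₀) :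
    slopeFamily i j L k₀ t v.row = t v := by
  have h : IsGeneric i j L v.row ∧ slope i j L v.row ≠ slope i j L k₀ :=
    ⟨v.isGeneric_row, by rw [v.slope_row]; exact v.2.1⟩
  rw [slopeFamily, dif_pos h]
  congr 1
  exact Subtype.ext v.slope_row

lemma slopeFamily_base {k₀ : Fin n} (t : SlopeIndex i j L k₀ → ℂ) :
    slopeFamily i j L k₀ t k₀ = 1 := by
  simp [slopeFamily]

lemma slopeFamily_eq_of_slope_eq {k₀ : Fin n} (t : SlopeIndex i j L k₀ → ℂ) {k l : Fin n}
    (hk : IsGeneric i j L k) (hl : IsGeneric i j L l) (h : slope i j L k = slope i j L l) :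
    slopeFamily i j L k₀ t k = slopeFamily i j L k₀ t l := by
  simp only [slopeFamily, hk, hl, h, true_and]

/-- The parameters for which the slopes are non-zero and as distinct as those of `L`. -/
def slopeDomain (i j : Fin n) (L : Gr n) (k₀ : Fin n) : Set (SlopeIndex i j L k₀ → ℂ) :=
  {t | (∀ k, slopeFamily i j L k₀ t k ≠ 0) ∧ ∀ k l, IsGeneric i j L k → IsGeneric i j L l →
    slope i j L k ≠ slope i j L l → slopeFamily i j L k₀ t k ≠ slopeFamily i j L k₀ t l}

lemma isOpen_slopeDomain (k₀ : Fin n) : IsOpen (slopeDomain i j L k₀) := by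
  have hc : ∀ k, Continuous fun t => slopeFamily i j L k₀ t k := fun k =>
    (continuous_apply k).comp (continuous_slopeFamily k₀)
  simp only [slopeDomain, Set.ofPred_and, Set.ofPred_forall]
  refine (isOpen_iInter_of_finite fun k => isOpen_ne_fun (hc k) continuous_const).inter ?_
  refine isOpen_iInter_of_finite fun k => isOpen_iInter_of_finite fun l => ?_
  refine isOpen_iInter_of_finite fun _ => isOpen_iInter_of_finite fun _ =>
    isOpen_iInter_of_finite fun _ => isOpen_ne_fun (hc k) (hc l)

lemma slopeDomain_nonempty {k₀ : Fin n} (h0 : ∀ k, IsGeneric i j L k → IsGeneric i j L k₀) :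
    (slopeDomain i j L k₀).Nonempty := by
  let t : SlopeIndex i j L k₀ → ℂ := fun v => v.1 / slope i j L k₀
  have ht : ∀ k, IsGeneric i j L k →
      slopeFamily i j L k₀ t k = slope i j L k / slope i j L k₀ := by
    intro k hk
    by_cases hs : slope i j L k = slope i j L k₀
    · simp [slopeFamily, hs, div_self (h0 k hk).slope_ne_zero]
    · simp [slopeFamily, hs, hk, t]
  refine ⟨t, fun k => ?_, fun k l hk hl hkl => ?_⟩
  · by_cases hk : IsGeneric i j L k
    · rw [ht k hk]; exact div_ne_zero hk.slope_ne_zero (h0 k hk).slope_ne_zero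
    · simp [slopeFamily, hk]
  · rw [ht k hk, ht l hl]
    intro h
    exact hkl ((div_left_inj' (h0 k hk).slope_ne_zero).1 h)

lemma slopeFamily_eq_iff {k₀ : Fin n} {t : SlopeIndex i j L k₀ → ℂ}
    (ht : t ∈ slopeDomain i j L k₀) {k l : Fin n} (hk : IsGeneric i j L k)
    (hl : IsGeneric i j L l) : slopeFamily i j L k₀ t k = slopeFamily i j L k₀ t l ↔
      slope i j L k = slope i j L l :=
  ⟨fun h => by_contra fun h' => ht.2 k l hk hl h' h, slopeFamily_eq_of_slope_eq t hk hl⟩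

open Classical in
/-- The order of vanishing of the slope of row `k` on a curve tending to `L`, up to a common shift:
the rows with `w_k = 0` come first, then the generic rows, then those with `z_k = 0`. Any two
different rows which are not both generic have different levels. -/
def level (i j : Fin n) (L : Gr n) (k : Fin n) : ℕ :=
  if zCoord i j L k = 0 then if wCoord i j L k = 0 then 2 * n + 1 + k else n + 1 + k
  else if wCoord i j L k = 0 then k else n

lemma level_eq_of_isGeneric {k : Fin n} (h : IsGeneric i j L k) : level i j L k = n := by
  simp [level, h.1, h.2]

lemma isGeneric_of_level_eq {k l : Fin n} (hkl : k ≠ l) (h : level i j L k = level i j L l) :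
    IsGeneric i j L k ∧ IsGeneric i j L l := by
  have h1 := k.2
  have h2 := l.2
  have h3 : (k : ℕ) ≠ l := fun h => hkl (Fin.ext h)
  simp only [IsGeneric]
  unfold level at h
  split_ifs at h <;> first | omega | exact ⟨⟨‹_›, ‹_›⟩, ‹_›, ‹_›⟩

lemma level_lt {k l : Fin n} (hz : zCoord i j L k ≠ 0) (hw : wCoord i j L l ≠ 0)
    (h : ¬ (IsGeneric i j L k ∧ IsGeneric i j L l)) : level i j L k < level i j L l := by
  have h1 := k.2
  simp only [IsGeneric, hz, hw, ne_eq, not_false_iff, true_and, and_true] at h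
  simp only [level, hz, hw, if_false]
  split_ifs with a b b
  · omega
  · omega
  · omega
  · exact absurd ⟨a, b⟩ h

/-- Rows of equal non-zero slope which are at least three in number can collide at different
relative speeds; these are detected by the blow-up along the corresponding centre. -/
theorem isEmpty_homeomorph_of_parallel (hij : i < j) (hL : plucker L i j ≠ 0) {κ μ ν : Fin n}
    (h1 : κ ≠ μ) (h2 : κ ≠ ν) (h3 : μ ≠ ν) (g1 : IsGeneric i j L κ) (g2 : IsGeneric i j L μ)
    (g3 : IsGeneric i j L ν) (e1 : slope i j L κ = slope i j L μ)
    (e2 : slope i j L κ = slope i j L ν) :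
    IsEmpty (ParameterSpace (support L) ≃ₜ virtualSpace i j (support L)) := by
  classical
  -- the speeds `a_k`; negative values of `s` keep them distinct
  let a : ℝ → Fin n → ℂ := fun s => Function.update (fun k : Fin n => ((k : ℕ) : ℂ)) κ (s : ℂ)
  let D : Set ((SlopeIndex i j L κ → ℂ) × ℝ) := slopeDomain i j L κ ×ˢ Set.Iio 0
  have ha : ∀ s < 0, ∀ k l, k ≠ l → a s k ≠ a s l := by
    have hs : ∀ s : ℝ, s < 0 → ∀ m : ℕ, (s : ℂ) ≠ (m : ℂ) := by
      intro s hs m h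
      have : s = m := by exact_mod_cast h
      have h4 : (0 : ℝ) ≤ m := Nat.cast_nonneg m
      linarith
    intro s hs0 k l hkl
    by_cases hk : k = κ
    · subst hk; simpa [a, Function.update_of_ne hkl.symm] using hs s hs0 l
    by_cases hl : l = κ
    · subst hl; simpa [a, Function.update_of_ne hkl] using (hs s hs0 k).symm
    · simpa [a, Function.update_of_ne hk, Function.update_of_ne hl, Fin.ext_iff] using
        fun h => hkl (Fin.ext h)
  have hadm : ∀ y : D, IsAdmissible i j (level i j L) (slopeFamily i j L κ y.1.1) (a y.1.2) :=
    fun y => ⟨y.2.1.1, fun k l _ _ _ _ hkl _ _ => ha _ y.2.2 k l hkl⟩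
  have hmem : ∀ y : D, limitPoint (hadm y) ∈ virtualSpace i j (support L) := fun y =>
    limitPoint_mem_virtualSpace hij hL (hadm y) (fun k l hk hl => slopeFamily_eq_iff y.2.1 hk hl)
      (fun k l hk hl => (level_eq_of_isGeneric hk).trans (level_eq_of_isGeneric hl).symm)
      fun k l hz hw h => level_lt hz hw h
  refine isEmpty_homeomorph_of_injective (k₀ := κ) hL (fun _ _ => g1) (D := D)
    ((isOpen_slopeDomain κ).prod isOpen_Iio)
    ((slopeDomain_nonempty fun _ _ => g1).prod ⟨-1, by norm_num⟩)
    (Ψ := fun y => ⟨limitPoint (hadm y), hmem y⟩) ?_ ?_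
  · refine Continuous.subtype_mk (continuous_limitPoint
      ((continuous_slopeFamily κ).comp (continuous_fst.comp continuous_subtype_val)) ?_ hadm
      (fun S => ∀ k ∈ S, ∀ l ∈ S, level i j L k = level i j L l ∧
        (k = l ∨ slope i j L k = slope i j L l)) ?_) _
    · exact (continuous_const.update κ (Complex.continuous_ofReal.comp
        (continuous_snd.comp continuous_subtype_val)))
    · intro y S
      refine forall₂_congr fun k _ => forall₂_congr fun l _ => and_congr_right fun hkl => ?_
      by_cases h : k = l
      · simp [h]
      · obtain ⟨gk, gl⟩ := isGeneric_of_level_eq h hkl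
        simp only [h, false_or]
        exact slopeFamily_eq_iff y.2.1 gk gl
  · rintro ⟨⟨t, s⟩, hy⟩ ⟨⟨t', s'⟩, hy'⟩ he
    have he : limitPoint (hadm ⟨(t, s), hy⟩) = limitPoint (hadm ⟨(t', s'), hy'⟩) :=
      congrArg Subtype.val he
    have ht : t = t' := by
      funext v
      have hne : v.row ≠ κ := fun h => v.2.1 (by rw [← v.slope_row, h])
      have := mul_eq_mul_of_limitPoint_eq he v.isGeneric_row.ne g1.ne hne
        ((level_eq_of_isGeneric v.isGeneric_row).trans (level_eq_of_isGeneric g1).symm)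
      simpa [slopeFamily_row, slopeFamily_base] using this
    subst ht
    let S : Cluster i j := ⟨{κ, μ, ν}, by simp [g1.ne.1.symm, g2.ne.1.symm, g3.ne.1.symm],
      by simp [g1.ne.2.symm, g2.ne.2.symm, g3.ne.2.symm],
      by rw [Finset.card_eq_three.2 ⟨κ, μ, ν, h1, h2, h3, rfl⟩]⟩
    have hS : ∀ k ∈ S.1, IsGeneric i j L k ∧ slope i j L k = slope i j L κ := by
      intro k hk
      simp only [S, Finset.mem_insert, Finset.mem_singleton] at hk
      rcases hk with rfl | rfl | rfl
      exacts [⟨g1, rfl⟩, ⟨g2, e1.symm⟩, ⟨g3, e2.symm⟩]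
    obtain ⟨c, hc⟩ := exists_sub_eq_of_limitPoint_eq he S (fun k hk l hl =>
      ⟨(level_eq_of_isGeneric (hS k hk).1).trans (level_eq_of_isGeneric (hS l hl).1).symm,
        slopeFamily_eq_of_slope_eq t (hS k hk).1 (hS l hl).1
          ((hS k hk).2.trans (hS l hl).2.symm)⟩)
    have c1 := hc μ (by simp [S]) ν (by simp [S]) h3
    have c2 := hc κ (by simp [S]) μ (by simp [S]) h1
    simp only [a, Function.update_self, Function.update_of_ne h1.symm,
      Function.update_of_ne h2.symm] at c1 c2
    have hne : ((μ : ℕ) : ℂ) - ((ν : ℕ) : ℂ) ≠ 0 :=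
      sub_ne_zero.2 fun h => h3 (Fin.ext (by exact_mod_cast h))
    -- the difference `a_μ - a_ν` does not involve `s`
    have hc1 : c = 1 := mul_right_cancel₀ hne (by rw [← c1, one_mul])
    rw [hc1, one_mul] at c2
    have hs : s = s' := by exact_mod_cast sub_left_inj.1 c2
    subst hs
    rfl

/-- If `z_κ w_ν = z_ν w_κ = 0`, the ratio of the slopes of the rows `κ` and `ν` in the limit is
arbitrary. The rows are given the same level and the ratio `s` is the additional parameter. -/
theorem isEmpty_homeomorph_of_free (hij : i < j) (hL : plucker L i j ≠ 0) {κ ν : Fin n}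
    (hκν : κ ≠ ν) (hκ : κ ≠ i ∧ κ ≠ j) (hν : ν ≠ i ∧ ν ≠ j)
    (h : (zCoord i j L κ = 0 ∧ wCoord i j L κ = 0) ∨
      (wCoord i j L κ = 0 ∧ zCoord i j L ν ≠ 0 ∧ wCoord i j L ν = 0) ∨
      (zCoord i j L κ = 0 ∧ zCoord i j L ν = 0 ∧ wCoord i j L ν ≠ 0)) :
    IsEmpty (ParameterSpace (support L) ≃ₜ virtualSpace i j (support L)) := by
  classical
  have gκ : ¬ IsGeneric i j L κ := by
    rintro ⟨a, b⟩
    rcases h with h | h | h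
    exacts [a h.1, b h.1, a h.1]
  have gne : ∀ {k}, IsGeneric i j L k → k ≠ κ := by rintro k hk rfl; exact gκ hk
  obtain ⟨k₀, h0⟩ : ∃ k₀, ∀ k, IsGeneric i j L k → IsGeneric i j L k₀ := by
    by_cases hg : ∃ k, IsGeneric i j L k
    · exact ⟨hg.choose, fun _ _ => hg.choose_spec⟩
    · exact ⟨i, fun k hk => absurd ⟨k, hk⟩ hg⟩
  -- with equal levels the ratio of the leading coefficients survives in the limit
  let d : Fin n → ℕ := Function.update (level i j L) κ (level i j L ν)
  have hdκ : d κ = level i j L ν := Function.update_self ..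
  have hdν : d ν = level i j L ν := Function.update_of_ne hκν.symm ..
  have hdne : ∀ {k}, k ≠ κ → d k = level i j L k := fun hk => Function.update_of_ne hk ..
  have hdg : ∀ {k}, IsGeneric i j L k → d k = n := fun hk =>
    (hdne (gne hk)).trans (level_eq_of_isGeneric hk)
  have hlt : ∀ k l, zCoord i j L k ≠ 0 → wCoord i j L l ≠ 0 →
      ¬ (IsGeneric i j L k ∧ IsGeneric i j L l) → d k < d l := by
    intro k l hz hw hg
    by_cases hk : k = κ
    · by_cases hl : l = κ
      · subst hk; subst hl; exact absurd ⟨hz, hw⟩ gκ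
      · subst hk
        rw [hdκ, hdne hl]
        rcases h with h | h | h
        · exact absurd h.1 hz
        · exact level_lt h.2.1 hw fun e => e.1.2 h.2.2
        · exact absurd h.1 hz
    · by_cases hl : l = κ
      · subst hl
        rw [hdκ, hdne hk]
        rcases h with h | h | h
        · exact absurd h.2 hw
        · exact absurd h.1 hw
        · exact level_lt hz h.2.2 fun e => e.2.1 h.2.1
      · rw [hdne hk, hdne hl]; exact level_lt hz hw hg
  let u : (SlopeIndex i j L k₀ → ℂ) × ℝ → Fin n → ℂ :=
    fun y => Function.update (slopeFamily i j L k₀ y.1) κ (y.2 : ℂ)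
  have huκ : ∀ y, u y κ = y.2 := fun y => Function.update_self ..
  have hune : ∀ y {k}, k ≠ κ → u y k = slopeFamily i j L k₀ y.1 k :=
    fun y k hk => Function.update_of_ne hk ..
  have huc : Continuous u := ((continuous_slopeFamily k₀).comp continuous_fst).update κ
    (Complex.continuous_ofReal.comp continuous_snd)
  let D : Set ((SlopeIndex i j L k₀ → ℂ) × ℝ) := {y | y.1 ∈ slopeDomain i j L k₀ ∧
    (y.2 : ℂ) ≠ 0 ∧ ∀ k, (y.2 : ℂ) ≠ slopeFamily i j L k₀ y.1 k}
  have hDo : IsOpen D := by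
    have hs : Continuous fun y : (SlopeIndex i j L k₀ → ℂ) × ℝ => (y.2 : ℂ) :=
      Complex.continuous_ofReal.comp continuous_snd
    simp only [D, Set.ofPred_and, Set.ofPred_forall]
    refine ((isOpen_slopeDomain k₀).preimage continuous_fst).inter
      ((isOpen_ne_fun hs continuous_const).inter (isOpen_iInter_of_finite fun k =>
        isOpen_ne_fun hs ?_))
    exact (continuous_apply k).comp ((continuous_slopeFamily k₀).comp continuous_fst)
  have hDne : D.Nonempty := by
    obtain ⟨t, ht⟩ := slopeDomain_nonempty h0
    -- a real number larger than all the slopes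
    let s : ℝ := 1 + ∑ k, ‖slopeFamily i j L k₀ t k‖
    have hsum : 0 ≤ ∑ k, ‖slopeFamily i j L k₀ t k‖ := Finset.sum_nonneg fun _ _ => norm_nonneg _
    have hs : 0 < s := by simp only [s]; linarith
    refine ⟨(t, s), ht, by exact_mod_cast hs.ne', fun k hk => ?_⟩
    have h1 : ‖slopeFamily i j L k₀ t k‖ ≤ ∑ k, ‖slopeFamily i j L k₀ t k‖ :=
      Finset.single_le_sum (f := fun k => ‖slopeFamily i j L k₀ t k‖)
        (fun _ _ => norm_nonneg _) (Finset.mem_univ k)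
    rw [← hk, Complex.norm_real, Real.norm_of_nonneg hs.le] at h1
    simp only [s] at h1
    linarith
  have hadm : ∀ y : D, IsAdmissible i j d (u y.1) fun k => ((k : ℕ) : ℂ) := by
    refine fun y => ⟨fun k => ?_, fun k l _ _ _ _ hkl _ _ (e : ((k : ℕ) : ℂ) = ((l : ℕ) : ℂ)) =>
      hkl (Fin.ext (by exact_mod_cast e))⟩
    by_cases hk : k = κ
    · rw [hk, huκ]; exact y.2.2.1
    · rw [hune _ hk]; exact y.2.1.1 k
  have hslope : ∀ y : D, ∀ k l, IsGeneric i j L k → IsGeneric i j L l →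
      (u y.1 k = u y.1 l ↔ slope i j L k = slope i j L l) := by
    intro y k l hk hl
    rw [hune _ (gne hk), hune _ (gne hl)]
    exact slopeFamily_eq_iff y.2.1 hk hl
  have hmem : ∀ y : D, limitPoint (hadm y) ∈ virtualSpace i j (support L) := fun y =>
    limitPoint_mem_virtualSpace hij hL (hadm y) (hslope y)
      (fun k l hk hl => (hdg hk).trans (hdg hl).symm) hlt
  refine isEmpty_homeomorph_of_injective (k₀ := k₀) hL h0 hDo hDne
    (Ψ := fun y => ⟨limitPoint (hadm y), hmem y⟩) ?_ ?_
  · refine Continuous.subtype_mk (continuous_limitPoint (huc.comp continuous_subtype_val)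
      continuous_const hadm
      (fun S => ∀ k ∈ S, ∀ l ∈ S, d k = d l ∧
        (k = l ∨ IsGeneric i j L k ∧ IsGeneric i j L l ∧ slope i j L k = slope i j L l)) ?_) _
    intro y S
    refine forall₂_congr fun k _ => forall₂_congr fun l _ => and_congr_right fun hkl => ?_
    by_cases hne : k = l
    · simp [hne]
    simp only [hne, false_or]
    by_cases hk : k = κ
    · subst hk
      simp only [gκ, false_and, iff_false]
      change ¬ u y.1 k = u y.1 l
      rw [huκ, hune _ (Ne.symm hne)]
      exact y.2.2.2 l
    by_cases hl : l = κ
    · subst hl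
      simp only [gκ, false_and, and_false, iff_false]
      change ¬ u y.1 k = u y.1 l
      rw [huκ, hune _ hne]
      exact (y.2.2.2 k).symm
    rw [hdne hk, hdne hl] at hkl
    obtain ⟨gk, gl⟩ := isGeneric_of_level_eq hne hkl
    simp only [gk, gl, true_and]
    exact hslope y k l gk gl
  · rintro ⟨⟨t, s⟩, hy⟩ ⟨⟨t', s'⟩, hy'⟩ he
    have he : limitPoint (hadm ⟨(t, s), hy⟩) = limitPoint (hadm ⟨(t', s'), hy'⟩) :=
      congrArg Subtype.val he
    have ht : t = t' := by
      funext v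
      have g0 := h0 _ v.isGeneric_row
      have hne : v.row ≠ k₀ := fun h => v.2.1 (by rw [← v.slope_row, h])
      have := mul_eq_mul_of_limitPoint_eq he v.isGeneric_row.ne g0.ne hne
        ((hdg v.isGeneric_row).trans (hdg g0).symm)
      rw [hune _ (gne v.isGeneric_row), hune _ (gne g0), hune _ (gne v.isGeneric_row),
        hune _ (gne g0)] at this
      simpa [slopeFamily_row, slopeFamily_base] using this
    subst ht
    have := mul_eq_mul_of_limitPoint_eq he hκ hν hκν (hdκ.trans hdν.symm)
    rw [huκ, huκ, hune _ hκν.symm, hune _ hκν.symm, mul_comm] at this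
    have hs : s = s' := by exact_mod_cast mul_left_cancel₀ (hy.1.1 ν) this
    subst hs
    rfl

end Excess

/-! ### Virtual spaces of parameters without excess -/

section NoExcess

variable {n : ℕ} {i j : Fin n} {L : Gr n}

/-- The homogeneous coordinates `(z_k w_l : z_l w_k)` determined by the equations of the chart. -/
def chartLine (A : Gr n) (p : ChartPair i j) : Fin 2 → ℂ :=
  ![zCoord i j A p.1.1 * wCoord i j A p.1.2, zCoord i j A p.1.2 * wCoord i j A p.1.1]

/-- No row of the chart matrix of `L` is zero and no three rows are parallel. -/
def IsSimple (L : Gr n) : Prop :=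
  (∀ k, ∃ l, plucker L k l ≠ 0) ∧ ∀ k l m, k ≠ l → k ≠ m → l ≠ m →
    ¬ (plucker L k l = 0 ∧ plucker L k m = 0 ∧ plucker L l m = 0)

lemma IsSimple.of_mem_stratum {A : Gr n} (hs : IsSimple L) (hA : A ∈ stratum (support L)) :
    IsSimple A := by
  simpa only [IsSimple, ne_eq, mem_stratum_support_iff.1 hA] using hs

lemma IsSimple.coord_ne_zero (hs : IsSimple L) (hL : plucker L i j ≠ 0) (k : Fin n) :
    ¬ (zCoord i j L k = 0 ∧ wCoord i j L k = 0) := by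
  rintro ⟨hz, hw⟩
  obtain ⟨l, hl⟩ := hs.1 k
  rw [ne_eq, plucker_eq_zero_iff_coord hL, hz, hw] at hl
  simp at hl

lemma chartLine_ne_zero (hs : IsSimple L) (hL : plucker L i j ≠ 0) (p : ChartPair i j) :
    chartLine L p ≠ 0 := by
  obtain ⟨⟨k, l⟩, hkl, hki, hkj, hli, hlj⟩ := p
  intro h
  have e0 : zCoord i j L k * wCoord i j L l = 0 := congrFun h 0
  have e1 : zCoord i j L l * wCoord i j L k = 0 := congrFun h 1
  have nk := hs.coord_ne_zero hL k
  have nl := hs.coord_ne_zero hL l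
  have hp : plucker L k l = 0 :=
    (plucker_eq_zero_iff_coord hL k l).2 (by rw [e0, mul_comm, e1])
  rcases mul_eq_zero.1 e0 with hz | hw
  · have hz' : zCoord i j L l = 0 :=
      (mul_eq_zero.1 e1).resolve_right fun hw => nk ⟨hz, hw⟩
    refine hs.2 j k l (Ne.symm hkj) (Ne.symm hlj) hkl.ne ⟨?_, ?_, hp⟩ <;>
      simp [plucker_eq_zero_iff_coord hL, zCoord_right, hz, hz']
  · have hw' : wCoord i j L k = 0 :=
      (mul_eq_zero.1 e1).resolve_left fun hz => nl ⟨hz, hw⟩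
    refine hs.2 i k l (Ne.symm hki) (Ne.symm hli) hkl.ne ⟨?_, ?_, hp⟩ <;>
      simp [plucker_eq_zero_iff_coord hL, wCoord_left, hw, hw']

lemma IsSimple.exists_ne_of_cluster (hs : IsSimple L) (S : Cluster i j) :
    ∃ p : ChartPair i j, p.1.1 ∈ S.1 ∧ p.1.2 ∈ S.1 ∧ plucker L p.1.1 p.1.2 ≠ 0 := by
  obtain ⟨k, l, m, hk, hl, hm, hkl, hkm, hlm⟩ := Finset.two_lt_card_iff.1 S.2.2.2
  by_contra! hno
  have key : ∀ {k l : Fin n}, k ∈ S.1 → l ∈ S.1 → k ≠ l → plucker L k l = 0 := by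
    intro k l hk hl hkl
    rcases exists_chartPair (S.ne_of_mem hk) (S.ne_of_mem hl) hkl with ⟨p, hp⟩ | ⟨p, hp⟩
    · have := hno p (by rwa [hp]) (by rwa [hp])
      rwa [hp] at this
    · have := hno p (by rwa [hp]) (by rwa [hp])
      rw [hp] at this
      rw [plucker_swap, this, neg_zero]
  exact hs.2 k l m hkl hkm hlm ⟨key hk hl hkl, key hk hm hkm, key hl hm hlm⟩

lemma sections_chartLine_ne_zero (hs : IsSimple L) (hL : plucker L i j ≠ 0) (S : Cluster i j) :
    sections S.1 (chartLine L : ChartPair i j → Fin 2 → ℂ) ≠ 0 := by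
  obtain ⟨p, h1, h2, hp⟩ := hs.exists_ne_of_cluster S
  refine sections_ne_zero (chartLine_ne_zero hs hL) h1 h2 fun h => hp ?_
  rw [plucker_eq_zero_iff_coord hL, mul_comm (wCoord i j L _)]
  exact h

/-- The point of the universal space determined by a point of the chart. -/
def chartLimit (hs : IsSimple L) (hL : plucker L i j ≠ 0) : Ambient i j :=
  (fun p => Projectivization.mk ℂ _ (chartLine_ne_zero hs hL p),
    fun S => Projectivization.mk ℂ _ (sections_chartLine_ne_zero hs hL S))

lemma rep_chartLimit_mul (hs : IsSimple L) (hL : plucker L i j ≠ 0) (p : ChartPair i j) :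
    ((chartLimit hs hL).1 p).rep 1 * (zCoord i j L p.1.1 * wCoord i j L p.1.2) =
      ((chartLimit hs hL).1 p).rep 0 * (zCoord i j L p.1.2 * wCoord i j L p.1.1) := by
  obtain ⟨c, -, hc⟩ := exists_rep_mk_eq _ (chartLine_ne_zero hs hL p)
  rw [show (chartLimit hs hL).1 p = Projectivization.mk ℂ _ (chartLine_ne_zero hs hL p) from rfl,
    hc, hc]
  simp only [chartLine, Matrix.cons_val_one, Matrix.cons_val_zero]
  ring

lemma exists_chartLine_eq_smul (hs : IsSimple L) (hL : plucker L i j ≠ 0) {u : Fin n → ℂ}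
    (hu : ∀ k, u k ≠ 0) (hus : ∀ k, IsGeneric i j L k → u k = slope i j L k)
    (p : ChartPair i j) : ∃ c : ℂ, chartLine L p = c • levelLine (level i j L) u 0 p := by
  have hne := chartLine_ne_zero hs hL p
  obtain ⟨⟨k, l⟩, hkl⟩ := p
  by_cases hg : IsGeneric i j L k ∧ IsGeneric i j L l
  · obtain ⟨gk, gl⟩ := hg
    refine ⟨wCoord i j L k * wCoord i j L l, ?_⟩
    have hk := gk.2
    have hl := gl.2
    funext e
    fin_cases e
    · simp [chartLine, levelLine, level_eq_of_isGeneric gk, level_eq_of_isGeneric gl, hus k gk,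
        slope]
      field_simp
    · simp [chartLine, levelLine, level_eq_of_isGeneric gk, level_eq_of_isGeneric gl, hus l gl,
        slope]
      field_simp
  · by_cases h0 : zCoord i j L k * wCoord i j L l = 0
    · by_cases h1 : zCoord i j L l * wCoord i j L k = 0
      · exact absurd (by funext e; fin_cases e <;> simp [chartLine, h0, h1]) hne
      have hlt := level_lt (left_ne_zero_of_mul h1) (right_ne_zero_of_mul h1) fun e => hg e.symm
      have h2 : level i j L k - level i j L l ≠ 0 := by omega
      refine ⟨zCoord i j L l * wCoord i j L k / u l, ?_⟩
      funext e
      fin_cases e <;> simp [chartLine, levelLine, h0, h2, Nat.sub_eq_zero_of_le hlt.le, hu]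
    · have h1 : zCoord i j L l * wCoord i j L k = 0 := by
        by_contra h1
        exact hg ⟨⟨left_ne_zero_of_mul h0, right_ne_zero_of_mul h1⟩,
          left_ne_zero_of_mul h1, right_ne_zero_of_mul h0⟩
      have hlt := level_lt (left_ne_zero_of_mul h0) (right_ne_zero_of_mul h0) hg
      have h2 : level i j L l - level i j L k ≠ 0 := by omega
      refine ⟨zCoord i j L k * wCoord i j L l / u k, ?_⟩
      funext e
      fin_cases e <;> simp [chartLine, levelLine, h1, h2, Nat.sub_eq_zero_of_le hlt.le, hu]

lemma chartLimit_mem_universalSpace (hij : i < j) (hs : IsSimple L) (hL : plucker L i j ≠ 0) :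
    chartLimit hs hL ∈ universalSpace i j := by
  classical
  let u : Fin n → ℂ := fun k => if IsGeneric i j L k then slope i j L k else 1
  have hu : ∀ k, u k ≠ 0 := by
    intro k
    by_cases hk : IsGeneric i j L k
    · simpa [u, hk] using hk.slope_ne_zero
    · simp [u, hk]
  have hus : ∀ k, IsGeneric i j L k → u k = slope i j L k := fun k hk => by simp [u, hk]
  have hadm : IsAdmissible i j (level i j L) u fun k => ((k : ℕ) : ℂ) :=
    ⟨hu, fun k l _ _ _ _ hkl _ _ (e : ((k : ℕ) : ℂ) = ((l : ℕ) : ℂ)) =>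
      hkl (Fin.ext (by exact_mod_cast e))⟩
  choose c hc using exists_chartLine_eq_smul hs hL hu hus
  have heq : chartLimit hs hL = limitPoint hadm := by
    refine Prod.ext (funext fun p => projMk_eq_projMk _ _ (hc p)) (funext fun S => ?_)
    have hC : ¬ IsCollision (level i j L) u S.1 := by
      intro hC
      obtain ⟨p, h1, h2, hp⟩ := hs.exists_ne_of_cluster S
      obtain ⟨e1, e2⟩ := hC _ h1 _ h2
      obtain ⟨g1, g2⟩ := isGeneric_of_level_eq p.2.1.ne e1
      rw [hus _ g1, hus _ g2] at e2
      exact hp ((plucker_eq_zero_iff_slope hL g1 g2).2 e2)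
    refine projMk_eq_projMk _ _ (c := ∏ b : ChartPair i j with b.1.1 ∈ S.1 ∧ b.1.2 ∈ S.1, c b) ?_
    simp only [blowUpVector, hC, if_false]
    rw [← sections_smul]
    exact congrArg (sections S.1) (funext hc)
  rw [heq]
  exact limitPoint_mem_universalSpace hij hadm

lemma coord_smul (t : Fin n → ℂˣ) (L : Gr n) (k : Fin n) :
    zCoord i j (t • L) k = (t k / t i : ℂ) * zCoord i j L k ∧
      wCoord i j (t • L) k = (t k / t j : ℂ) * wCoord i j L k := by
  obtain ⟨c, hc, h⟩ := exists_plucker_smul t L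
  have hi := (t i).ne_zero
  have hj := (t j).ne_zero
  by_cases h1 : plucker L i j = 0
  · simp [zCoord, wCoord, h, h1]
  simp only [zCoord, wCoord, h]
  constructor <;> field_simp

lemma chartLine_smul (t : Fin n → ℂˣ) (L : Gr n) (p : ChartPair i j) :
    chartLine (t • L) p = (t p.1.1 * t p.1.2 / (t i * t j) : ℂ) • chartLine L p := by
  have hi := (t i).ne_zero
  have hj := (t j).ne_zero
  funext e
  fin_cases e <;>
  · simp [chartLine, coord_smul]
    field_simp

lemma chartLimit_eq_of_smul {A B : Gr n} (hA : IsSimple A) (hB : IsSimple B)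
    (hA0 : plucker A i j ≠ 0) (hB0 : plucker B i j ≠ 0) (h : ∃ t : Fin n → ℂˣ, t • B = A) :
    chartLimit hA hA0 = chartLimit hB hB0 := by
  obtain ⟨t, rfl⟩ := h
  refine Prod.ext (funext fun p => projMk_eq_projMk _ _ (chartLine_smul t B p))
    (funext fun S => projMk_eq_projMk _ _ ((congrArg (sections S.1)
      (funext (chartLine_smul t B))).trans (sections_smul S.1 _ _)))

/-- In the absence of excess, the equations determine the point of the universal space. -/
lemma exists_chartLimit_eq (hs : IsSimple L) (hL : plucker L i j ≠ 0) (hij : i ≠ j)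
    {x : Ambient i j} (hx : x ∈ virtualSpace i j (support L)) :
    ∃ (A : Gr n) (hA : A ∈ stratum (support L)),
      x = chartLimit (hs.of_mem_stratum hA) (plucker_base_ne_zero hL hA) := by
  obtain ⟨hxu, A, hA, z, w, hzw, heq⟩ := hx
  have hs' := hs.of_mem_stratum hA
  have hA0 := plucker_base_ne_zero hL hA
  refine ⟨A, hA, ?_⟩
  have h1 : ∀ p, x.1 p = Projectivization.mk ℂ _ (chartLine_ne_zero hs' hA0 p) := by
    intro p
    have hp := heq p
    obtain ⟨e1, e2⟩ := coord_eq_of_eq_colSpan hij hzw p.2.2.1 p.2.2.2.1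
    obtain ⟨e3, e4⟩ := coord_eq_of_eq_colSpan hij hzw p.2.2.2.2.1 p.2.2.2.2.2
    rw [← e1, ← e2, ← e3, ← e4] at hp
    refine projMk_eq_of_mul_eq _ fun a b => ?_
    fin_cases a <;> fin_cases b
    · rfl
    · exact hp.symm
    · exact hp
    · rfl
  refine Prod.ext (funext h1) (funext fun S => projMk_eq_of_mul_eq _ fun a b => ?_)
  obtain ⟨c, hc, hsec⟩ := span_idealSections_mk S.1 (chartLine A) (chartLine_ne_zero hs' hA0)
  have hrel := rep_mul_idealSections_of_mem_universalSpace hxu S a b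
  rw [show x.1 = _ from funext h1, hsec] at hrel
  simp only [Pi.smul_apply, smul_eq_mul] at hrel
  refine mul_left_cancel₀ hc ?_
  linear_combination hrel

lemma continuous_chartLimit (hs : IsSimple L) (hL : plucker L i j ≠ 0) :
    Continuous fun A : {A : Gr n // A ∈ stratum (support L)} =>
      chartLimit (hs.of_mem_stratum A.2) (plucker_base_ne_zero hL A.2) := by
  have hl : Continuous fun A : {A : Gr n // A ∈ stratum (support L)} =>
      (chartLine A.1 : ChartPair i j → Fin 2 → ℂ) := by
    refine continuous_pi fun p => continuous_pi fun e => ?_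
    fin_cases e
    · exact (continuous_zCoord hL p.1.1).mul (continuous_wCoord hL p.1.2)
    · exact (continuous_zCoord hL p.1.2).mul (continuous_wCoord hL p.1.1)
  have hsec : ∀ S : Finset (Fin n), Continuous
      fun v : ChartPair i j → Fin 2 → ℂ => sections S v := by
    refine fun S => continuous_pi fun q => ?_
    by_cases hq : q.1.1.1 ∈ S ∧ q.1.1.2 ∈ S <;>
      simp only [sections, hq, and_self, if_true, if_false] <;> fun_prop
  refine Continuous.prodMk (continuous_pi fun p => ?_) (continuous_pi fun S => ?_)
  · exact continuous_projMk ((continuous_apply p).comp hl) _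
  · exact continuous_projMk ((hsec S.1).comp hl) _

/-- Ratios of slopes are continuous functions on the virtual space of parameters. -/
lemma exists_continuous_slope_div (hs : IsSimple L) (hL : plucker L i j ≠ 0) {k k₀ : Fin n}
    (hk : IsGeneric i j L k) (hk₀ : IsGeneric i j L k₀) :
    ∃ r : virtualSpace i j (support L) → ℂ, Continuous r ∧
      ∀ (x : virtualSpace i j (support L)) (A : Gr n) (hA : A ∈ stratum (support L)),
        x.1 = chartLimit (hs.of_mem_stratum hA) (plucker_base_ne_zero hL hA) →
        r x = slope i j A k / slope i j A k₀ := by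
  have hij := ne_of_plucker_ne_zero hL
  have hcont : ∀ (p : ChartPair i j) (e e' : Fin 2),
      (∀ A ∈ stratum (support L), chartLine A p e' ≠ 0) →
      Continuous fun x : virtualSpace i j (support L) => (x.1.1 p).rep e / (x.1.1 p).rep e' := by
    intro p e e' h
    refine (continuousOn_rep_div e' e).comp_continuous
      (f := fun x : virtualSpace i j (support L) => x.1.1 p)
      ((continuous_apply p).comp (continuous_fst.comp continuous_subtype_val)) fun x => ?_
    obtain ⟨A, hA, hx⟩ := exists_chartLimit_eq hs hL hij x.2
    rw [hx]
    exact (rep_mk_ne_zero_iff _ _ e').2 (h A hA)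
  have hval : ∀ (p : ChartPair i j) (e e' : Fin 2) (x : virtualSpace i j (support L)) (A : Gr n)
      (hA : A ∈ stratum (support L)),
      x.1 = chartLimit (hs.of_mem_stratum hA) (plucker_base_ne_zero hL hA) →
      (x.1.1 p).rep e / (x.1.1 p).rep e' = chartLine A p e / chartLine A p e' := by
    intro p e e' x A hA hx
    rw [hx]
    exact rep_mk_div _ _ e' e
  have hgen : ∀ A ∈ stratum (support L), IsGeneric i j A k ∧ IsGeneric i j A k₀ := fun A hA =>
    ⟨(isGeneric_iff hL hA k).2 hk, (isGeneric_iff hL hA k₀).2 hk₀⟩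
  by_cases hkk : k = k₀
  · subst hkk
    exact ⟨fun _ => 1, continuous_const, fun x A hA _ =>
      (div_self (hgen A hA).1.slope_ne_zero).symm⟩
  rcases exists_chartPair hk.ne hk₀.ne hkk with ⟨p, hp⟩ | ⟨p, hp⟩
  · refine ⟨_, hcont p 0 1 fun A hA => ?_, fun x A hA hx => ?_⟩
    · obtain ⟨g, g₀⟩ := hgen A hA
      simp only [chartLine, hp, Matrix.cons_val_one]
      exact mul_ne_zero g₀.1 g.2
    · obtain ⟨⟨g1, g2⟩, g3, g4⟩ := hgen A hA
      rw [hval p 0 1 x A hA hx]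
      simp only [chartLine, hp, Matrix.cons_val_one, Matrix.cons_val_zero, slope]
      field_simp
  · refine ⟨_, hcont p 1 0 fun A hA => ?_, fun x A hA hx => ?_⟩
    · obtain ⟨g, g₀⟩ := hgen A hA
      simp only [chartLine, hp, Matrix.cons_val_zero]
      exact mul_ne_zero g₀.1 g.2
    · obtain ⟨⟨g1, g2⟩, g3, g4⟩ := hgen A hA
      rw [hval p 1 0 x A hA hx]
      simp only [chartLine, hp, Matrix.cons_val_one, Matrix.cons_val_zero, slope]
      field_simp

/-- If `L` has no zero row and no three parallel rows, the space of parameters and the virtual space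
of parameters of its stratum are homeomorphic. -/
theorem nonempty_homeomorph_of_isSimple (hij : i < j) (hs : IsSimple L) (hL : plucker L i j ≠ 0) :
    Nonempty (ParameterSpace (support L) ≃ₜ virtualSpace i j (support L)) := by
  classical
  obtain ⟨k₀, h0⟩ : ∃ k₀, ∀ k, IsGeneric i j L k → IsGeneric i j L k₀ := by
    by_cases hg : ∃ k, IsGeneric i j L k
    · exact ⟨hg.choose, fun _ _ => hg.choose_spec⟩
    · exact ⟨i, fun k hk => absurd ⟨k, hk⟩ hg⟩
  let f : {A : Gr n // A ∈ stratum (support L)} → virtualSpace i j (support L) := fun A =>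
    ⟨chartLimit (hs.of_mem_stratum A.2) (plucker_base_ne_zero hL A.2),
      chartLimit_mem_universalSpace hij _ _, A.1, A.2, zCoord i j A.1, wCoord i j A.1,
      congrArg Subtype.val (chartPoint_coord hij.ne (plucker_base_ne_zero hL A.2)).symm,
      rep_chartLimit_mul (hs.of_mem_stratum A.2) (plucker_base_ne_zero hL A.2)⟩
  have hf : Continuous f := (continuous_chartLimit hs hL).subtype_mk _
  obtain ⟨F, hF, hFf⟩ := exists_continuous_lift hf fun A B h =>
    Subtype.ext (chartLimit_eq_of_smul (hs.of_mem_stratum A.2) (hs.of_mem_stratum B.2)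
      (plucker_base_ne_zero hL A.2) (plucker_base_ne_zero hL B.2) h)
  have hr : ∀ k, ∃ r : virtualSpace i j (support L) → ℂ, Continuous r ∧ (IsGeneric i j L k →
      ∀ (x : virtualSpace i j (support L)) (A : Gr n) (hA : A ∈ stratum (support L)),
        x.1 = chartLimit (hs.of_mem_stratum hA) (plucker_base_ne_zero hL hA) →
        r x = slope i j A k / slope i j A k₀) := by
    intro k
    by_cases hk : IsGeneric i j L k
    · obtain ⟨r, h1, h2⟩ := exists_continuous_slope_div hs hL hk (h0 k hk)
      exact ⟨r, h1, fun _ => h2⟩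
    · exact ⟨fun _ => 1, continuous_const, fun h => absurd h hk⟩
  choose r hrc hrv using hr
  have hmem : ∀ x, chartPoint hij.ne (normalZ i j L fun k => r k x) (normalW i j L) ∈
      stratum (support L) := by
    intro x
    obtain ⟨A, hA, hx⟩ := exists_chartLimit_eq hs hL hij.ne x.2
    have g : ∀ {k}, IsGeneric i j L k → IsGeneric i j A k := fun hk => (isGeneric_iff hL hA _).2 hk
    refine normalPoint_mem_stratum hij.ne hL (fun k hk => ?_) fun k l hk hl => ?_
    · rw [hrv k hk x A hA hx]
      exact div_ne_zero (g hk).slope_ne_zero (g (h0 k hk)).slope_ne_zero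
    · rw [hrv k hk x A hA hx, hrv l hl x A hA hx, div_left_inj' (g (h0 k hk)).slope_ne_zero,
        ← plucker_eq_zero_iff_slope (plucker_base_ne_zero hL hA) (g hk) (g hl),
        mem_stratum_support_iff.1 hA, plucker_eq_zero_iff_slope hL hk hl]
  let G : virtualSpace i j (support L) → ParameterSpace (support L) := fun x => paramMk ⟨_, hmem x⟩
  have hG : Continuous G := by
    refine continuous_paramMk.comp (Continuous.subtype_mk (continuous_chartPoint hij.ne
      (continuous_pi fun k => ?_) continuous_const) _)
    unfold normalZ
    split_ifs
    · exact continuous_const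
    · exact continuous_const
    · exact hrc k
  have hGf : ∀ A, G (f A) = paramMk A := by
    intro A
    rw [paramMk_eq_iff]
    refine exists_smul_eq_of_slope hL A.2 (hmem (f A)) fun k l hk hl => ?_
    have hsl : ∀ {k}, IsGeneric i j L k →
        slope i j (chartPoint hij.ne (normalZ i j L fun k => r k (f A)) (normalW i j L)) k =
          slope i j A.1 k / slope i j A.1 k₀ := by
      intro k hk
      obtain ⟨e1, e2⟩ := coord_normalPoint hij.ne hL (fun k => r k (f A)) k
      rw [← hrv k hk (f A) A.1 A.2 rfl, slope, e1, e2]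
      simp [normalZ, normalW, hk.1, hk.2]
    rw [hsl hk, hsl hl]
    ring
  refine ⟨⟨⟨F, G, fun y => ?_, fun x => ?_⟩, hF, hG⟩⟩
  · obtain ⟨A, rfl⟩ := exists_paramMk_eq y
    rw [hFf, hGf]
  · obtain ⟨A, hA, hx⟩ := exists_chartLimit_eq hs hL hij.ne x.2
    obtain rfl : x = f ⟨A, hA⟩ := Subtype.ext hx
    rw [hGf, hFf]

end NoExcess

/-! ### Singular points -/

section Singular

variable {n : ℕ} {i j : Fin n} {L : Gr n}

/-- In each chart, the two spaces of parameters are homeomorphic if and only if there are no zero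
row and no three parallel rows. -/
theorem isEmpty_homeomorph_iff (hn : 4 ≤ n) (hij : i < j) (hL : plucker L i j ≠ 0) :
    IsEmpty (ParameterSpace (support L) ≃ₜ virtualSpace i j (support L)) ↔ ¬ IsSimple L := by
  constructor
  · intro h hs
    exact not_isEmpty_iff.2 (nonempty_homeomorph_of_isSimple hij hs hL) h
  intro hs
  by_cases hz : ∃ k, zCoord i j L k = 0 ∧ wCoord i j L k = 0
  · obtain ⟨k, hk⟩ := hz
    have hki : k ≠ i := by
      rintro rfl; rw [zCoord_left hL] at hk; exact one_ne_zero hk.1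
    have hkj : k ≠ j := by
      rintro rfl; rw [wCoord_right hL] at hk; exact one_ne_zero hk.2
    -- there is a further row, since `n ≥ 4`
    obtain ⟨l, hl⟩ : ∃ l, l ∉ ({i, j, k} : Finset (Fin n)) := by
      by_contra! hall
      have h1 : (Finset.univ : Finset (Fin n)).card ≤ ({i, j, k} : Finset (Fin n)).card :=
        Finset.card_le_card fun l _ => hall l
      have h2 := Finset.card_le_three (a := i) (b := j) (c := k)
      rw [Finset.card_univ, Fintype.card_fin] at h1
      omega
    simp only [Finset.mem_insert, Finset.mem_singleton, not_or] at hl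
    exact isEmpty_homeomorph_of_free hij hL (Ne.symm hl.2.2) ⟨hki, hkj⟩ ⟨hl.1, hl.2.1⟩ (Or.inl hk)
  have hrow : ∀ k, ∃ l, plucker L k l ≠ 0 := by
    intro k
    by_contra! h
    refine hz ⟨k, ?_, ?_⟩
    · simp [zCoord, h]
    · simp [wCoord, plucker_swap L i, h]
  have htriple : ∃ k l m, k ≠ l ∧ k ≠ m ∧ l ≠ m ∧
      plucker L k l = 0 ∧ plucker L k m = 0 ∧ plucker L l m = 0 := by
    by_contra! h
    exact hs ⟨hrow, fun k l m h1 h2 h3 h4 => h k l m h1 h2 h3 h4.1 h4.2.1 h4.2.2⟩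
  push Not at hz
  -- two more rows parallel to row `i`, or to row `j`
  have hI : ∀ {k l}, k ≠ l → k ≠ i → l ≠ i → plucker L i k = 0 → plucker L i l = 0 →
      IsEmpty (ParameterSpace (support L) ≃ₜ virtualSpace i j (support L)) := by
    intro k l hkl hki hli h1 h2
    have hkj : k ≠ j := by rintro rfl; exact hL h1
    have hlj : l ≠ j := by rintro rfl; exact hL h2
    have wk : wCoord i j L k = 0 := by simp [wCoord, h1]
    have wl : wCoord i j L l = 0 := by simp [wCoord, h2]
    exact isEmpty_homeomorph_of_free hij hL hkl ⟨hki, hkj⟩ ⟨hli, hlj⟩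
      (Or.inr (Or.inl ⟨wk, fun h => hz l h wl, wl⟩))
  have hJ : ∀ {k l}, k ≠ l → k ≠ j → l ≠ j → plucker L k j = 0 → plucker L l j = 0 →
      IsEmpty (ParameterSpace (support L) ≃ₜ virtualSpace i j (support L)) := by
    intro k l hkl hkj hlj h1 h2
    have hki : k ≠ i := by rintro rfl; exact hL h1
    have hli : l ≠ i := by rintro rfl; exact hL h2
    have zk : zCoord i j L k = 0 := by simp [zCoord, h1]
    have zl : zCoord i j L l = 0 := by simp [zCoord, h2]
    exact isEmpty_homeomorph_of_free hij hL hkl ⟨hki, hkj⟩ ⟨hli, hlj⟩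
      (Or.inr (Or.inr ⟨zk, zl, hz l zl⟩))
  obtain ⟨k, l, m, hkl, hkm, hlm, p1, p2, p3⟩ := htriple
  -- parallelism of non-zero rows is transitive
  have hw : ∀ {a b : Fin n}, plucker L a b = 0 → wCoord i j L a = 0 → wCoord i j L b = 0 := by
    intro a b hab ha
    rw [plucker_eq_zero_iff_coord hL, ha, zero_mul] at hab
    exact (mul_eq_zero.1 hab).resolve_left fun h => hz a h ha
  have hz' : ∀ {a b : Fin n}, plucker L a b = 0 → zCoord i j L a = 0 → zCoord i j L b = 0 := by
    intro a b hab ha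
    rw [plucker_eq_zero_iff_coord hL, ha, zero_mul] at hab
    exact (mul_eq_zero.1 hab.symm).resolve_left fun h => hz a ha h
  have pw : ∀ {a : Fin n}, wCoord i j L a = 0 → plucker L i a = 0 := fun h =>
    (div_eq_zero_iff.1 h).resolve_right hL
  have pz : ∀ {a : Fin n}, zCoord i j L a = 0 → plucker L a j = 0 := fun h =>
    (div_eq_zero_iff.1 h).resolve_right hL
  by_cases wk : wCoord i j L k = 0
  · have wl := hw p1 wk
    have wm := hw p2 wk
    by_cases hk : k = i
    · exact hI hlm (hk ▸ hkl.symm) (hk ▸ hkm.symm) (pw wl) (pw wm)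
    by_cases hl : l = i
    · exact hI hkm hk (hl ▸ hlm.symm) (pw wk) (pw wm)
    · exact hI hkl hk hl (pw wk) (pw wl)
  by_cases zk : zCoord i j L k = 0
  · have zl := hz' p1 zk
    have zm := hz' p2 zk
    by_cases hk : k = j
    · exact hJ hlm (hk ▸ hkl.symm) (hk ▸ hkm.symm) (pz zl) (pz zm)
    by_cases hl : l = j
    · exact hJ hkm hk (hl ▸ hlm.symm) (pz zk) (pz zm)
    · exact hJ hkl hk hl (pz zk) (pz zl)
  have swap : ∀ {a b : Fin n}, plucker L a b = 0 → plucker L b a = 0 := fun h => by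
    rw [plucker_swap, h, neg_zero]
  have gk : IsGeneric i j L k := ⟨zk, wk⟩
  have gl : IsGeneric i j L l := ⟨fun h => zk (hz' (swap p1) h), fun h => wk (hw (swap p1) h)⟩
  have gm : IsGeneric i j L m := ⟨fun h => zk (hz' (swap p2) h), fun h => wk (hw (swap p2) h)⟩
  exact isEmpty_homeomorph_of_parallel hij hL hkl hkm hlm gk gl gm
    ((plucker_eq_zero_iff_slope hL gk gl).1 p1) ((plucker_eq_zero_iff_slope hL gk gm).1 p2)

lemma isSingularInChart_iff (hn : 4 ≤ n) (hij : i < j) :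
    IsSingularInChart i j (orbitPoint L) ↔ plucker L i j ≠ 0 ∧ ¬ IsSimple L := by
  constructor
  · rintro ⟨L', hL', hne, hempty⟩
    obtain ⟨t, rfl⟩ : ∃ t : Fin n → Circle, t • L = L' :=
      (MulAction.orbitRel_apply.1 (Quotient.exact hL'))
    have hsupp : support (t • L) = support L := support_smul (compactTorus n t) L
    obtain ⟨c, hc, hp⟩ := exists_plucker_smul (compactTorus n t) L
    have hne' : plucker (compactTorus n t • L) i j ≠ 0 := hne
    rw [hp] at hne'
    have hL := right_ne_zero_of_mul (right_ne_zero_of_mul hne')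
    rw [hsupp] at hempty
    exact ⟨hL, (isEmpty_homeomorph_iff hn hij hL).1 hempty⟩
  · rintro ⟨hL, hs⟩
    exact ⟨L, rfl, hL, (isEmpty_homeomorph_iff hn hij hL).2 hs⟩

lemma exists_plucker_ne_zero (L : Gr n) : ∃ i j, i < j ∧ plucker L i j ≠ 0 := by
  obtain ⟨k, l, h⟩ := (finrank_colSpan_iff (frame L)).1 (by rw [colSpan_frame]; exact L.2)
  rcases lt_trichotomy k l with hkl | hkl | hkl
  · exact ⟨k, l, hkl, h⟩
  · exact absurd (hkl ▸ plucker_self L k) h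
  · exact ⟨l, k, hkl, fun h0 => h (by
      have := plucker_swap L k l
      rw [h0, neg_zero] at this
      exact this)⟩

lemma isSingular_iff (hn : 4 ≤ n) : IsSingular (orbitPoint L) ↔ ¬ IsSimple L := by
  constructor
  · rintro ⟨i, j, hij, h⟩
    exact ((isSingularInChart_iff hn hij).1 h).2
  · intro hs
    obtain ⟨i, j, hij, h⟩ := exists_plucker_ne_zero L
    exact ⟨i, j, hij, (isSingularInChart_iff hn hij).2 ⟨h, hs⟩⟩

lemma not_isSimple_iff : ¬ IsSimple L ↔ (∃ i : Fin n, ∀ j : Fin n, j ≠ i → plucker L i j = 0) ∨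
    ∃ i j k : Fin n, i < j ∧ j < k ∧ plucker L i j = 0 ∧ plucker L i k = 0 ∧ plucker L j k = 0 := by
  rw [IsSimple, not_and_or]
  refine or_congr ?_ ?_
  · push Not
    refine exists_congr fun i => ⟨fun h j _ => h j, fun h j => ?_⟩
    by_cases hj : j = i
    · rw [hj, plucker_self]
    · exact h j hj
  · constructor
    · intro h
      push Not at h
      obtain ⟨k, l, m, h1, h2, h3, p1, p2, p3⟩ := h
      have swap : ∀ {a b : Fin n}, plucker L a b = 0 → plucker L b a = 0 := fun h => by
        rw [plucker_swap, h, neg_zero]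
      rcases lt_or_gt_of_ne h1 with a | a <;> rcases lt_or_gt_of_ne h2 with b | b <;>
        rcases lt_or_gt_of_ne h3 with c | c
      · exact ⟨k, l, m, a, c, p1, p2, p3⟩
      · exact ⟨k, m, l, b, c, p2, p1, swap p3⟩
      · exact absurd (a.trans c) b.not_gt
      · exact ⟨m, k, l, b, a, swap p2, swap p3, p1⟩
      · exact ⟨l, k, m, a, b, swap p1, p3, p2⟩
      · exact absurd (a.trans b) c.not_gt
      · exact ⟨l, m, k, c, b, p3, swap p1, swap p2⟩
      · exact ⟨m, l, k, c, a, swap p3, swap p2, swap p1⟩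
    · rintro ⟨k, l, m, h1, h2, p⟩ h
      exact h k l m h1.ne (h1.trans h2).ne h2.ne p

end Singular

end GrassmannTorus

end

theorem mainTheorem7 (n : ℕ) (hn : 4 ≤ n) (L : GrassmannTorus.Gr n) :
    (GrassmannTorus.IsSingular (GrassmannTorus.orbitPoint L) ↔
      ((∃ i : Fin n, ∀ j : Fin n, j ≠ i → GrassmannTorus.plucker L i j = 0) ∨
        ∃ i j k : Fin n, i < j ∧ j < k ∧ GrassmannTorus.plucker L i j = 0 ∧
          GrassmannTorus.plucker L i k = 0 ∧ GrassmannTorus.plucker L j k = 0)) ∧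
    ∀ i j : Fin n, i < j → GrassmannTorus.plucker L i j ≠ 0 →
      (GrassmannTorus.IsSingularInChart i j (GrassmannTorus.orbitPoint L) ↔
        GrassmannTorus.IsSingular (GrassmannTorus.orbitPoint L)) := by
  refine ⟨(GrassmannTorus.isSingular_iff hn).trans GrassmannTorus.not_isSimple_iff,
    fun i j hij hL => ?_⟩
  rw [GrassmannTorus.isSingularInChart_iff hn hij, GrassmannTorus.isSingular_iff hn]
  exact and_iff_right hL
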